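/- Let $k$ be an arbitrary field and let $R=\begin{pmatrix} k & k^2\\ 0 & k\end{pmatrix}$ be the Kronecker algebra, with $k$-$k$-bimodule structure $a(b,c)d=(abd,acd)$ on $k^2$. Left $R$-modules are identified with representations $\alpha,\beta\colon M_2\rightrightarrows M_1$ of the Kronecker quiver, where $M_1=e_{1}M$, $M_2=e_{2}M$ for the diagonal matrix idempotents $e_1,e_2$, and $\alpha,\beta$ are the actions of the elements $(1,0),(0,1)\in k^2$. The defect of a finite-dimensional $R$-module $M$ is $\dim_k M_2-\dim_k M_1$. A finite-dimensional module is regular if all its indecomposable direct summands have defect $0$ (equivalently, if it has no nonzero preprojective or preinjective direct summand); a simple regular module is a nonzero regular module whose only regular submodules are $0$ and itself; a regular module has regular length $n$ if it has a chain of submodules of length $n$ from $0$ to itself with simple regular factors, and its regular socle is the sum of its simple regular submodules. For a simple regular module $U$ and $n\ge 1$ let $U[n]$ be the indecomposable regular module of regular length $n$ with regular socle isomorphic to $U$; the Prüfer module $U[\infty]=\varinjlim_n U[n]$ is a module that is the union of a chain of submodules $U[1]\subset U[2]\subset\cdots$. Let $V$ be the representation $k\rightrightarrows k$ with $\alpha=0$,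 $\beta=1$. For a monic irreducible polynomial $p(x)\in k[x]$ let $k_{p(x)}=k[x]/(p(x))$, and let $V_{p(x)}$ be the representation $k_{p(x)}\rightrightarrows k_{p(x)}$ with $\alpha=1$ and $\beta$ the multiplication by $x$. Then the Prüfer modules $V[\infty]$ and $V_{p(x)}[\infty]$ exist, and any such modules have endomorphism rings $$\operatorname{End}_R(V[\infty])\simeq k[[t]]\qquad\text{and}\qquad \operatorname{End}_R(V_{p(x)}[\infty])\simeq k_{p(x)}[[t]]$$ as rings, for every monic irreducible $p(x)\in k[x]$, where $t$ is a variable. -/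

import Mathlib

open Polynomial

universe u v w

/-- The Kronecker algebra over `k`: the ring of triangular matrices `(a, (c, d); 0, b)` with
`a, b ∈ k` and `(c, d)` in the bimodule `k²`. -/
@[ext]
structure KroneckerAlgebra (k : Type u) where
  /-- upper left entry -/
  a : k
  /-- first coordinate of the upper right entry -/
  c : k
  /-- second coordinate of the upper right entry -/
  d : k
  /-- lower right entry -/
  b : k

namespace KroneckerAlgebra

section Ring

variable {k : Type u} [Field k]

instance : Zero (KroneckerAlgebra k) := ⟨⟨0, 0, 0, 0⟩⟩

instance : One (KroneckerAlgebra k) := ⟨⟨1, 0, 0, 1⟩⟩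

instance : Add (KroneckerAlgebra k) :=
  ⟨fun r s => ⟨r.a + s.a, r.c + s.c, r.d + s.d, r.b + s.b⟩⟩

instance : Neg (KroneckerAlgebra k) := ⟨fun r => ⟨-r.a, -r.c, -r.d, -r.b⟩⟩

/-- Matrix multiplication. -/
instance : Mul (KroneckerAlgebra k) :=
  ⟨fun r s => ⟨r.a * s.a, r.a * s.c + r.c * s.b, r.a * s.d + r.d * s.b, r.b * s.b⟩⟩

instance : SMul k (KroneckerAlgebra k) := ⟨fun t r => ⟨t * r.a, t * r.c, t * r.d, t * r.b⟩⟩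

@[simp] theorem zero_a : (0 : KroneckerAlgebra k).a = 0 := rfl
@[simp] theorem zero_b : (0 : KroneckerAlgebra k).b = 0 := rfl
@[simp] theorem zero_c : (0 : KroneckerAlgebra k).c = 0 := rfl
@[simp] theorem zero_d : (0 : KroneckerAlgebra k).d = 0 := rfl
@[simp] theorem one_a : (1 : KroneckerAlgebra k).a = 1 := rfl
@[simp] theorem one_b : (1 : KroneckerAlgebra k).b = 1 := rfl
@[simp] theorem one_c : (1 : KroneckerAlgebra k).c = 0 := rfl
@[simp] theorem one_d : (1 : KroneckerAlgebra k).d = 0 := rfl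
@[simp] theorem add_a (r s : KroneckerAlgebra k) : (r + s).a = r.a + s.a := rfl
@[simp] theorem add_b (r s : KroneckerAlgebra k) : (r + s).b = r.b + s.b := rfl
@[simp] theorem add_c (r s : KroneckerAlgebra k) : (r + s).c = r.c + s.c := rfl
@[simp] theorem add_d (r s : KroneckerAlgebra k) : (r + s).d = r.d + s.d := rfl
@[simp] theorem neg_a (r : KroneckerAlgebra k) : (-r).a = -r.a := rfl
@[simp] theorem neg_b (r : KroneckerAlgebra k) : (-r).b = -r.b := rfl
@[simp] theorem neg_c (r : KroneckerAlgebra k) : (-r).c = -r.c := rfl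
@[simp] theorem neg_d (r : KroneckerAlgebra k) : (-r).d = -r.d := rfl
@[simp] theorem mul_a (r s : KroneckerAlgebra k) : (r * s).a = r.a * s.a := rfl
@[simp] theorem mul_b (r s : KroneckerAlgebra k) : (r * s).b = r.b * s.b := rfl
@[simp] theorem mul_c (r s : KroneckerAlgebra k) : (r * s).c = r.a * s.c + r.c * s.b := rfl
@[simp] theorem mul_d (r s : KroneckerAlgebra k) : (r * s).d = r.a * s.d + r.d * s.b := rfl
@[simp] theorem smul_a (t : k) (r : KroneckerAlgebra k) : (t • r).a = t * r.a := rfl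
@[simp] theorem smul_b (t : k) (r : KroneckerAlgebra k) : (t • r).b = t * r.b := rfl
@[simp] theorem smul_c (t : k) (r : KroneckerAlgebra k) : (t • r).c = t * r.c := rfl
@[simp] theorem smul_d (t : k) (r : KroneckerAlgebra k) : (t • r).d = t * r.d := rfl

instance : Ring (KroneckerAlgebra k) where
  add_assoc r s t := by ext <;> simp <;> ring
  zero_add r := by ext <;> simp
  add_zero r := by ext <;> simp
  add_comm r s := by ext <;> simp <;> ring
  neg_add_cancel r := by ext <;> simp
  mul_assoc r s t := by ext <;> simp <;> ring
  one_mul r := by ext <;> simp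
  mul_one r := by ext <;> simp
  left_distrib r s t := by ext <;> simp <;> ring
  right_distrib r s t := by ext <;> simp <;> ring
  zero_mul r := by ext <;> simp
  mul_zero r := by ext <;> simp
  nsmul := nsmulRec
  zsmul := zsmulRec

instance : Module k (KroneckerAlgebra k) where
  one_smul r := by ext <;> simp
  mul_smul s t r := by ext <;> simp <;> ring
  smul_zero t := by ext <;> simp
  smul_add t r s := by ext <;> simp <;> ring
  add_smul s t r := by ext <;> simp <;> ring
  zero_smul r := by ext <;> simp

instance : Algebra k (KroneckerAlgebra k) :=
  Algebra.ofModule (fun t r s => by ext <;> simp <;> ring) (fun t r s => by ext <;> simp <;> ring)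

/-- The idempotent of the vertex `1`, the sink of the Kronecker quiver. -/
def e₁ (k : Type u) [Field k] : KroneckerAlgebra k := ⟨1, 0, 0, 0⟩

/-- The idempotent of the vertex `2`, the source of the Kronecker quiver. -/
def e₂ (k : Type u) [Field k] : KroneckerAlgebra k := ⟨0, 0, 0, 1⟩

end Ring

section Rep

variable {k : Type u} [Field k] {M₁ : Type v} {M₂ : Type w} [AddCommGroup M₁] [AddCommGroup M₂]
  [Module k M₁] [Module k M₂]

/-- The module over the Kronecker algebra given by the representation
`α, β : M₂ ⇉ M₁` of the Kronecker quiver; its underlying space is `M₁ × M₂`. -/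
def Rep (_α _β : M₂ →ₗ[k] M₁) : Type (max v w) := M₁ × M₂

variable (α β : M₂ →ₗ[k] M₁)

instance : AddCommGroup (Rep α β) := inferInstanceAs (AddCommGroup (M₁ × M₂))

instance : Module k (Rep α β) := inferInstanceAs (Module k (M₁ × M₂))

instance : SMul (KroneckerAlgebra k) (Rep α β) :=
  ⟨fun r m => (r.a • m.1 + r.c • α m.2 + r.d • β m.2, r.b • m.2)⟩

@[simp] theorem Rep.smul_fst (r : KroneckerAlgebra k) (m : Rep α β) :
    (r • m).1 = r.a • m.1 + r.c • α m.2 + r.d • β m.2 := rfl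

@[simp] theorem Rep.smul_snd (r : KroneckerAlgebra k) (m : Rep α β) : (r • m).2 = r.b • m.2 := rfl

@[simp] theorem Rep.add_fst (m n : Rep α β) : (m + n).1 = m.1 + n.1 := rfl

@[simp] theorem Rep.add_snd (m n : Rep α β) : (m + n).2 = m.2 + n.2 := rfl

@[simp] theorem Rep.zero_fst : (0 : Rep α β).1 = 0 := rfl

@[simp] theorem Rep.zero_snd : (0 : Rep α β).2 = 0 := rfl

@[simp] theorem Rep.field_smul_fst (t : k) (m : Rep α β) : (t • m).1 = t • m.1 := rfl

@[simp] theorem Rep.field_smul_snd (t : k) (m : Rep α β) : (t • m).2 = t • m.2 := rfl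

instance : Module (KroneckerAlgebra k) (Rep α β) where
  one_smul m := by
    refine Prod.ext ?_ ?_ <;> simp
  mul_smul r s m := by
    refine Prod.ext ?_ ?_ <;> simp [mul_smul, add_smul]
    abel
  smul_zero r := by
    refine Prod.ext ?_ ?_ <;> simp
  smul_add r m n := by
    refine Prod.ext ?_ ?_ <;> simp
    abel
  add_smul r s m := by
    refine Prod.ext ?_ ?_ <;> simp [add_smul]
    abel
  zero_smul m := by
    refine Prod.ext ?_ ?_ <;> simp

instance : IsScalarTower k (KroneckerAlgebra k) (Rep α β) where
  smul_assoc t r m := by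
    refine Prod.ext ?_ ?_ <;> simp [mul_smul]

end Rep

/-- The representation `V`, with `α = 0` and `β = 1` on `k`. -/
abbrev V (k : Type u) [Field k] : Type u :=
  Rep (0 : k →ₗ[k] k) (LinearMap.id : k →ₗ[k] k)

/-- The representation `V_p`, with `α = 1` and `β` the multiplication by `x` on `k[x]/(p)`. -/
abbrev Vp {k : Type u} [Field k] (p : k[X]) : Type u :=
  Rep (LinearMap.id : AdjoinRoot p →ₗ[k] AdjoinRoot p)
    (LinearMap.mulLeft k (AdjoinRoot.root p))

/-- A module is indecomposable if it is nonzero and is not the direct sum of two nonzero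
submodules. -/
def IsIndecomposable (R : Type u) (M : Type v) [Ring R] [AddCommGroup M] [Module R M] : Prop :=
  Nontrivial M ∧ ∀ A B : Submodule R M, IsCompl A B → A = ⊥ ∨ B = ⊥

section Regular

/- Modules over the Kronecker algebra carry the `k`-vector space structure that comes from
`k → KroneckerAlgebra k`; this is what `IsScalarTower k (KroneckerAlgebra k) M` says. -/
variable (k : Type u) [Field k] (M : Type v) [AddCommGroup M] [Module k M]
  [Module (KroneckerAlgebra k) M] [IsScalarTower k (KroneckerAlgebra k) M]

/-- The subspace `e M` of a module `M`. -/
def cornerSpace (e : KroneckerAlgebra k) : Submodule k M :=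
  LinearMap.range (Algebra.lsmul k k M e)

/-- The defect `⟨δ, dim M⟩` of a finite-dimensional module, where `δ = (1, 1)` and
`⟨x, y⟩ = x₁ y₁ + x₂ y₂ - 2 x₂ y₁` is the Euler form of the Kronecker quiver, that is,
`dim e₂ M - dim e₁ M`. -/
noncomputable def defect : ℤ :=
  (Module.finrank k (cornerSpace k M (e₂ k)) : ℤ) - Module.finrank k (cornerSpace k M (e₁ k))

/-- Regular modules: finite-dimensional modules all of whose indecomposable direct summands have
defect zero (the indecomposable modules of negative and of positive defect are the
preprojective and the preinjective ones). -/
def IsRegular : Prop :=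
  Module.Finite k M ∧
    ∀ A B : Submodule (KroneckerAlgebra k) M, IsCompl A B →
      IsIndecomposable (KroneckerAlgebra k) A → defect k A = 0

/-- Simple regular modules: nonzero regular modules without regular submodules other than zero
and the whole module. -/
def IsSimpleRegular : Prop :=
  Nontrivial M ∧ IsRegular k M ∧
    ∀ N : Submodule (KroneckerAlgebra k) M, IsRegular k N → N = ⊥ ∨ N = ⊤

/-- `M` has a regular composition series of length `n`. -/
def HasRegularLength (n : ℕ) : Prop :=
  ∃ c : ℕ → Submodule (KroneckerAlgebra k) M, c 0 = ⊥ ∧ c n = ⊤ ∧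
    ∀ i < n, c i ≤ c (i + 1) ∧ IsSimpleRegular k (c (i + 1) ⧸ (c i).submoduleOf (c (i + 1)))

/-- The regular socle: the sum of all simple regular submodules. -/
def regularSocle : Submodule (KroneckerAlgebra k) M :=
  sSup {N | IsSimpleRegular k N}

variable (U : Type w) [AddCommGroup U] [Module (KroneckerAlgebra k) U]

/-- `M` is (isomorphic to) the module `U[n]`: the indecomposable regular module of regular length
`n` with regular socle `U`. -/
def IsRayModule (n : ℕ) : Prop :=
  IsIndecomposable (KroneckerAlgebra k) M ∧ IsRegular k M ∧ HasRegularLength k M n ∧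
    Nonempty (regularSocle k M ≃ₗ[KroneckerAlgebra k] U)

/-- `M` is (isomorphic to) the Prüfer module `U[∞]`: the union of a chain
`U[1] ⊆ U[2] ⊆ ⋯` of submodules. -/
def IsPrufer : Prop :=
  ∃ c : ℕ → Submodule (KroneckerAlgebra k) M, Monotone c ∧ (⨆ n, c n) = ⊤ ∧
    ∀ n, 1 ≤ n → IsRayModule k (c n) U n

end Regular

end KroneckerAlgebra

/-
On a Prüfer module one of the two arrows acts bijectively, so the module is the representation of a
`k[X]`-module `P`, with the other arrow acting as `X`. Being the union of the modules `U[n]`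
amounts to `P` being `p`-primary with `k[X] / (p)` as its `p`-torsion, and divisible by `p`. The
endomorphisms of such a `P` act locally as scalars, hence form a commutative ring; it is complete
for the powers of the nonzerodivisor `p`, and its quotient by `p` is the field `k[X] / (p)`. Since
`k[X]` contains the prime field, over which every field is formally smooth, the residue field lifts
(Cohen's structure theorem in dimension one) and the endomorphism ring is `(k[X] / (p))[[t]]`.
Conversely, `k[X][1/p] / k[X]` is such a `P`.
-/

section FormallySmooth

open KaehlerDifferential TensorProduct

theorem one_tmul_D_mvPolynomial_eq_zero_iff {R A ι : Type*} [CommRing R] [CommRing A]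
    [Algebra (MvPolynomial ι R) A] (f : MvPolynomial ι R) :
    (1 : A) ⊗ₜ[MvPolynomial ι R] D R (MvPolynomial ι R) f = 0 ↔
      ∀ i, algebraMap (MvPolynomial ι R) A (MvPolynomial.pderiv i f) = 0 := by
  rw [← ((mvPolynomialBasis R ι).baseChange A).repr.map_eq_zero_iff, Finsupp.ext_iff]
  refine forall_congr' fun i => ?_
  rw [Module.Basis.baseChange_repr_tmul, mvPolynomialBasis_repr_apply, Algebra.smul_def, mul_one,
    Finsupp.zero_apply]

theorem subsingleton_h1Cotangent_iff_pderiv {R A ι : Type*} [CommRing R] [CommRing A]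
    [Algebra R A] (φ : MvPolynomial ι R →ₐ[R] A) (hφ : Function.Surjective φ) :
    Subsingleton (Algebra.H1Cotangent R A) ↔
      ∀ f, φ f = 0 → (∀ i, φ (MvPolynomial.pderiv i f) = 0) → f ∈ RingHom.ker φ ^ 2 := by
  let : Algebra (MvPolynomial ι R) A := φ.toRingHom.toAlgebra
  have : IsScalarTower R (MvPolynomial ι R) A := .of_algebraMap_eq fun r => (φ.commutes r).symm
  rw [← Algebra.FormallySmooth.kerCotangentToTensor_injective_iff (P := MvPolynomial ι R) hφ,
    injective_iff_map_eq_zero]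
  constructor
  · intro h f hf hd
    refine (Ideal.toCotangent_eq_zero _ _).1 (h (Ideal.toCotangent _ ⟨f, hf⟩) ?_)
    rw [kerCotangentToTensor_toCotangent]
    exact (one_tmul_D_mvPolynomial_eq_zero_iff f).2 hd
  · intro h x hx
    obtain ⟨⟨f, hf⟩, rfl⟩ := Ideal.toCotangent_surjective _ x
    rw [kerCotangentToTensor_toCotangent] at hx
    exact (Ideal.toCotangent_eq_zero _ _).2
      (h f hf ((one_tmul_D_mvPolynomial_eq_zero_iff f).1 hx))

theorem aeval_id_rename_val {K L : Type*} [Field K] [Field L] [Algebra K L]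
    (F : IntermediateField K L) (g : MvPolynomial F K) :
    MvPolynomial.aeval (id : L → L) (MvPolynomial.rename Subtype.val g) =
      algebraMap F L (MvPolynomial.aeval (id : F → F) g) := by
  rw [MvPolynomial.aeval_rename]
  exact MvPolynomial.aeval_algebraMap_apply L (id : F → F) g

theorem subsingleton_h1Cotangent_of_forall_fg {K L : Type*} [Field K] [Field L] [Algebra K L]
    (h : ∀ F : IntermediateField K L, F.FG → Subsingleton (Algebra.H1Cotangent K F)) :
    Subsingleton (Algebra.H1Cotangent K L) := by
  rw [subsingleton_h1Cotangent_iff_pderiv (MvPolynomial.aeval (id : L → L))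
    fun x => ⟨MvPolynomial.X x, by simp⟩]
  intro f hf hd
  let F : IntermediateField K L := IntermediateField.adjoin K (f.vars : Set L)
  obtain ⟨g, hgf⟩ := MvPolynomial.exists_rename_eq_of_vars_subset_range f (Subtype.val : F → L)
    Subtype.val_injective fun x hx => by
      rw [Subtype.range_coe]; exact IntermediateField.subset_adjoin K _ hx
  rw [← hgf] at hf hd ⊢
  have hF := h F (IntermediateField.fg_adjoin_finset _)
  rw [subsingleton_h1Cotangent_iff_pderiv (MvPolynomial.aeval (id : F → F))
    fun x => ⟨MvPolynomial.X x, by simp⟩] at hF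
  have hinj := FaithfulSMul.algebraMap_injective F L
  have hg : g ∈ RingHom.ker (MvPolynomial.aeval (id : F → F) : MvPolynomial F K →ₐ[K] F) ^ 2 :=
    hF g (hinj (by rw [← aeval_id_rename_val, hf, map_zero])) fun i => hinj (by
      rw [← aeval_id_rename_val, ← MvPolynomial.pderiv_rename Subtype.val_injective, hd, map_zero])
  refine Ideal.pow_right_mono ?_ 2 (Ideal.map_pow (MvPolynomial.rename Subtype.val :
    MvPolynomial F K →ₐ[K] MvPolynomial L K) _ 2 ▸ Ideal.mem_map_of_mem _ hg)
  refine Ideal.map_le_iff_le_comap.2 fun q hq => ?_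
  rw [Ideal.mem_comap, RingHom.mem_ker, aeval_id_rename_val, (RingHom.mem_ker).1 hq, map_zero]

theorem formallySmooth_of_perfectField (K L : Type*) [Field K] [Field L] [Algebra K L]
    [PerfectField K] : Algebra.FormallySmooth K L := by
  refine ⟨inferInstance, subsingleton_h1Cotangent_of_forall_fg fun F hF => ?_⟩
  have := IntermediateField.essFiniteType_iff.2 hF
  exact (Algebra.FormallySmooth.of_perfectField (K := K) (L := F)).subsingleton_h1Cotangent

end FormallySmooth

section AdicEvaluation

variable {K E : Type*} [CommRing K] [CommRing E] (σ : K →+* E) (t : E)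

theorem mk_eval₂_eq_of_coeff_eq {n : ℕ} {f g : K[X]} (h : ∀ i < n, f.coeff i = g.coeff i) :
    Ideal.Quotient.mk (Ideal.span {t} ^ n) (f.eval₂ σ t) =
      Ideal.Quotient.mk (Ideal.span {t} ^ n) (g.eval₂ σ t) := by
  have hdvd : X ^ n ∣ f - g :=
    X_pow_dvd_iff.2 fun i hi => by rw [coeff_sub, h i hi, sub_self]
  rw [Ideal.Quotient.eq, Ideal.span_singleton_pow, Ideal.mem_span_singleton, ← eval₂_sub]
  simpa using eval₂_dvd σ t hdvd

/-- Evaluation of power series at `t` modulo `t ^ n`, the coefficients being mapped by `σ`. -/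
noncomputable def truncEval (n : ℕ) : PowerSeries K →+* E ⧸ Ideal.span {t} ^ n where
  toFun φ := Ideal.Quotient.mk _ ((φ.trunc n).eval₂ σ t)
  map_zero' := by simp
  map_one' := by
    rw [← map_one (Ideal.Quotient.mk _), ← eval₂_one σ t]
    refine mk_eval₂_eq_of_coeff_eq σ t fun i hi => ?_
    rw [PowerSeries.coeff_trunc, if_pos hi, ← Polynomial.coeff_coe, Polynomial.coe_one]
  map_add' φ ψ := by rw [map_add, eval₂_add, map_add]
  map_mul' φ ψ := by
    rw [← map_mul, ← eval₂_mul]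
    refine mk_eval₂_eq_of_coeff_eq σ t fun i hi => ?_
    rw [← PowerSeries.trunc_trunc_mul_trunc, PowerSeries.coeff_trunc, if_pos hi,
      ← Polynomial.coe_mul, Polynomial.coeff_coe]

theorem factorPow_comp_truncEval {m n : ℕ} (hmn : m ≤ n) :
    (Ideal.Quotient.factorPow (Ideal.span {t}) hmn).comp (truncEval σ t n) = truncEval σ t m := by
  refine RingHom.ext fun φ => mk_eval₂_eq_of_coeff_eq σ t fun i hi => ?_
  rw [PowerSeries.coeff_trunc, PowerSeries.coeff_trunc, if_pos (hi.trans_le hmn), if_pos hi]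

variable [IsAdicComplete (Ideal.span {t}) E]

/-- Evaluation of power series at `t` in a `t`-adically complete ring, the coefficients being
mapped by `σ`. -/
noncomputable def adicEval : PowerSeries K →+* E :=
  IsAdicComplete.liftRingHom (Ideal.span {t}) (truncEval σ t) (factorPow_comp_truncEval σ t)

theorem mk_adicEval (n : ℕ) (φ : PowerSeries K) :
    Ideal.Quotient.mk (Ideal.span {t} ^ n) (adicEval σ t φ) =
      Ideal.Quotient.mk _ ((φ.trunc n).eval₂ σ t) :=
  IsAdicComplete.mk_liftRingHom (Ideal.span {t}) _ _ n φ

variable {σ t}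

theorem adicEval_injective (ht : t ∈ nonZeroDivisors E)
    (hσ : Function.Injective ((Ideal.Quotient.mk (Ideal.span {t})).comp σ)) :
    Function.Injective (adicEval σ t) := by
  refine (injective_iff_map_eq_zero _).2 fun φ hφ => PowerSeries.ext fun n => ?_
  rw [map_zero]
  induction n using Nat.strong_induction_on with
  | _ n ih =>
    have htrunc : φ.trunc (n + 1) = monomial n (φ.coeff n) := by
      rw [PowerSeries.trunc_succ, add_eq_right]
      ext i
      rw [PowerSeries.coeff_trunc, Polynomial.coeff_zero, ite_eq_right_iff]
      exact ih i
    have hdvd := mk_adicEval σ t (n + 1) φ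
    rw [hφ, map_zero, htrunc, eval₂_monomial, eq_comm, Ideal.Quotient.eq_zero_iff_mem,
      Ideal.span_singleton_pow, Ideal.mem_span_singleton, pow_succ, mul_comm (σ _),
      dvd_cancel_left_mem_nonZeroDivisors (pow_mem ht n), ← Ideal.mem_span_singleton,
      ← Ideal.Quotient.eq_zero_iff_mem] at hdvd
    exact (map_eq_zero_iff _ hσ).1 hdvd

theorem adicEval_surjective
    (hσ : Function.Surjective ((Ideal.Quotient.mk (Ideal.span {t})).comp σ)) :
    Function.Surjective (adicEval σ t) := by
  have hdigit (e : E) : ∃ (a : K) (r : E), e = σ a + t * r := by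
    obtain ⟨a, ha⟩ := hσ (Ideal.Quotient.mk _ e)
    obtain ⟨r, hr⟩ := Ideal.mem_span_singleton.1 (Ideal.Quotient.eq.1 ha.symm)
    exact ⟨a, r, eq_add_of_sub_eq' hr⟩
  choose a r har using hdigit
  intro e
  have hexp (n : ℕ) : e = ((PowerSeries.mk fun n => a (r^[n] e)).trunc n).eval₂ σ t +
      t ^ n * r^[n] e := by
    induction n with
    | zero => simp
    | succ n ih =>
      rw [PowerSeries.trunc_succ, eval₂_add, eval₂_monomial, PowerSeries.coeff_mk,
        Function.iterate_succ_apply']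
      linear_combination ih + t ^ n * har (r^[n] e)
  refine ⟨PowerSeries.mk fun n => a (r^[n] e), ?_⟩
  refine (IsHausdorff.eq_iff_smodEq (I := Ideal.span {t})).2 fun n => ?_
  rw [smul_eq_mul, Ideal.mul_top]
  refine (mk_adicEval σ t n _).trans (Ideal.Quotient.eq.2 ?_)
  rw [Ideal.span_singleton_pow, Ideal.mem_span_singleton, ← neg_sub, dvd_neg,
    sub_eq_of_eq_add' (hexp n)]
  exact dvd_mul_right _ _

end AdicEvaluation

theorem perfectField_bot (F : Type*) [Field F] : PerfectField (⊥ : Subfield F) := by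
  obtain ⟨p, hp⟩ := CharP.exists F
  rcases CharP.char_is_prime_or_zero F p with hprime | rfl
  · have : Fact p.Prime := ⟨hprime⟩
    let := ZMod.algebra F p
    have : Finite (⊥ : Subfield F) := by
      rw [Subfield.bot_eq_of_zMod_algebra p]
      exact inferInstanceAs (Finite (Set.range (algebraMap (ZMod p) F)))
    infer_instance
  · have := CharP.charP_to_charZero F
    infer_instance

theorem exists_section_of_isAdicComplete (F : Type*) {E : Type*} [Field F] [CommRing E]
    [Algebra F E] (I : Ideal E) [I.IsMaximal] [IsAdicComplete I E] :
    ∃ σ : E ⧸ I →+* E, (Ideal.Quotient.mk I).comp σ = RingHom.id (E ⧸ I) := by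
  let := Ideal.Quotient.field I
  let := ((algebraMap F E).comp (algebraMap (⊥ : Subfield F) F)).toAlgebra
  have := perfectField_bot F
  have := formallySmooth_of_perfectField (⊥ : Subfield F) (E ⧸ I)
  obtain ⟨σ, hσ⟩ := Algebra.FormallySmooth.exists_mkₐ_comp_eq_of_isAdicComplete
    (AlgHom.id (⊥ : Subfield F) (E ⧸ I))
  exact ⟨σ, RingHom.ext fun a => DFunLike.congr_fun hσ a⟩

theorem nonempty_ringEquiv_powerSeries_of_isAdicComplete (F : Type*) {E K : Type*} [Field F]
    [CommRing E] [Algebra F E] [CommRing K] {t : E} (ht : t ∈ nonZeroDivisors E)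
    [(Ideal.span {t}).IsMaximal] [IsAdicComplete (Ideal.span {t}) E]
    (e : K ≃+* E ⧸ Ideal.span {t}) : Nonempty (E ≃+* PowerSeries K) := by
  obtain ⟨σ, hσ⟩ := exists_section_of_isAdicComplete F (Ideal.span {t})
  have hbij : Function.Bijective
      ((Ideal.Quotient.mk (Ideal.span {t})).comp (σ.comp (e : K →+* E ⧸ Ideal.span {t}))) := by
    rw [← RingHom.comp_assoc, hσ, RingHom.id_comp]
    exact e.bijective
  exact ⟨(RingEquiv.ofBijective (adicEval _ t)
    ⟨adicEval_injective ht hbij.injective, adicEval_surjective hbij.surjective⟩).symm⟩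

section ResidueField

variable {S P : Type*} [CommRing S] [AddCommGroup P] [Module S P] {p : S} {v : P}
  [hp : (Ideal.span {p}).IsMaximal]

theorem torsionOf_eq_span (hv0 : v ≠ 0) (hv : p • v = 0) :
    Ideal.torsionOf S P v = Ideal.span {p} := by
  refine (hp.eq_of_le ?_ ?_).symm
  · rwa [Ne, Ideal.torsionOf_eq_top_iff]
  · rwa [Ideal.span_singleton_le_iff_mem, Ideal.mem_torsionOf_iff]

theorem mem_span_smul_of_isMaximal (hv : p • v = 0) {f : S} (hf : f • v ≠ 0) :
    v ∈ Submodule.span S {f • v} := by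
  have hfp : f ∉ Ideal.span {p} := fun hmem => by
    obtain ⟨c, rfl⟩ := Ideal.mem_span_singleton'.1 hmem
    exact hf (by rw [mul_smul, hv, smul_zero])
  obtain ⟨g, i, hi, hgi⟩ := hp.exists_inv hfp
  obtain ⟨c, rfl⟩ := Ideal.mem_span_singleton'.1 hi
  refine Submodule.mem_span_singleton.2 ⟨g, ?_⟩
  rw [← mul_smul, eq_sub_of_add_eq hgi, sub_smul, one_smul, mul_smul c, hv, smul_zero, sub_zero]

/-- A nonzero element killed by `p` generates a copy of the residue field of `p`. -/
noncomputable def quotEquivSpanSingleton (hv0 : v ≠ 0) (hv : p • v = 0) :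
    (S ⧸ Ideal.span {p}) ≃ₗ[S] Submodule.span S {v} :=
  (Submodule.quotEquivOfEq _ _ (torsionOf_eq_span hv0 hv).symm).trans
    (Ideal.quotTorsionOfEquivSpanSingleton S P v)

end ResidueField

/-- `P` is a `p`-primary `S`-module whose `p`-torsion is generated by the nonzero element `v`. If
`p` generates a maximal ideal, then the submodules of such a module form a chain. -/
structure IsUniserialAt {S P : Type*} [CommRing S] [AddCommGroup P] [Module S P] (p : S) (v : P) :
    Prop where
  torsion : ∀ u : P, ∃ n : ℕ, p ^ n • u = 0
  ne_zero : v ≠ 0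
  torsionBy_eq_span : Submodule.torsionBy S P p = Submodule.span S {v}

namespace IsUniserialAt

variable {S P : Type*} [CommRing S] [AddCommGroup P] [Module S P] {p : S} {v : P}

theorem smul_eq_zero (h : IsUniserialAt p v) : p • v = 0 := by
  rw [← Submodule.mem_torsionBy_iff, h.torsionBy_eq_span]
  exact Submodule.mem_span_singleton_self v

theorem torsionBy_pow_succ_eq_span (h : IsUniserialAt p v) {n : ℕ} {w : P} (hw : p ^ n • w = v) :
    Submodule.torsionBy S P (p ^ (n + 1)) = Submodule.span S {w} := by
  induction n generalizing w with
  | zero =>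
    rw [pow_zero, one_smul] at hw
    rw [zero_add, pow_one, h.torsionBy_eq_span, hw]
  | succ n ih =>
    have hv : v ∈ Submodule.span S {w} :=
      hw ▸ Submodule.smul_mem _ _ (Submodule.mem_span_singleton_self w)
    refine le_antisymm (fun u hu => ?_) ?_
    · have hpu : p • u ∈ Submodule.torsionBy S P (p ^ (n + 1)) := by
        rwa [Submodule.mem_torsionBy_iff, ← mul_smul, ← pow_succ]
      rw [ih (w := p • w) (by rwa [← mul_smul, ← pow_succ])] at hpu
      obtain ⟨f, hf⟩ := Submodule.mem_span_singleton.1 hpu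
      have hdiff : u - f • w ∈ Submodule.torsionBy S P p := by
        rw [Submodule.mem_torsionBy_iff, smul_sub, ← hf, smul_comm, sub_self]
      rw [h.torsionBy_eq_span] at hdiff
      exact (Submodule.sub_mem_iff_left _
        (Submodule.smul_mem _ f (Submodule.mem_span_singleton_self w))).1
        ((Submodule.span_singleton_le_iff_mem _ _).2 hv hdiff)
    · rw [Submodule.span_singleton_le_iff_mem, Submodule.mem_torsionBy_iff, pow_succ', mul_smul,
        hw, h.smul_eq_zero]

theorem submodule (h : IsUniserialAt p v) {Q : Submodule S P} (hv : v ∈ Q) :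
    IsUniserialAt p (⟨v, hv⟩ : Q) where
  torsion u := (h.torsion u).imp fun _ hn => Subtype.ext hn
  ne_zero h0 := h.ne_zero (congrArg Subtype.val h0)
  torsionBy_eq_span := by
    ext u
    have hu : u ∈ Submodule.torsionBy S Q p ↔ (u : P) ∈ Submodule.torsionBy S P p :=
      Subtype.ext_iff
    rw [hu, h.torsionBy_eq_span, Submodule.mem_span_singleton, Submodule.mem_span_singleton]
    exact exists_congr fun f => (Subtype.ext_iff (a1 := f • (⟨v, hv⟩ : Q))).symm

theorem map_pow_smul_torsionBy (h : IsUniserialAt p v) {n : ℕ} {w : P} (hw : p ^ n • w = v) :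
    (Submodule.torsionBy S P (p ^ (n + 1))).map (LinearMap.lsmul S P (p ^ n)) =
      Submodule.span S {v} := by
  rw [h.torsionBy_pow_succ_eq_span hw, Submodule.map_span, Set.image_singleton,
    LinearMap.lsmul_apply, hw]

section Chain

variable [(Ideal.span {p}).IsMaximal]

theorem exists_pow_smul_eq (h : IsUniserialAt p v) {u : P} (hu : u ≠ 0) :
    ∃ (n : ℕ) (w : P), p ^ n • w = v ∧ Submodule.span S {w} = Submodule.span S {u} := by
  obtain ⟨n, hn : p ^ n • u ≠ 0, hn' : p ^ (n + 1) • u = 0⟩ :=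
    Nat.exists_not_and_succ_of_not_zero_of_exists (by rwa [pow_zero, one_smul]) (h.torsion u)
  have hmem : p ^ n • u ∈ Submodule.torsionBy S P p := by
    rwa [Submodule.mem_torsionBy_iff, ← mul_smul, ← pow_succ']
  rw [h.torsionBy_eq_span] at hmem
  obtain ⟨f, hf⟩ := Submodule.mem_span_singleton.1 hmem
  obtain ⟨g, hg⟩ := Submodule.mem_span_singleton.1
    (mem_span_smul_of_isMaximal h.smul_eq_zero (hf ▸ hn))
  have hw : p ^ n • g • u = v := by rw [smul_comm, ← hf, hg]
  refine ⟨n, g • u, hw, le_antisymm ?_ ?_⟩ <;> rw [Submodule.span_singleton_le_iff_mem]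
  · exact Submodule.smul_mem _ _ (Submodule.mem_span_singleton_self u)
  · rwa [← h.torsionBy_pow_succ_eq_span hw, Submodule.mem_torsionBy_iff]

theorem mem_of_ne_bot (h : IsUniserialAt p v) {Q : Submodule S P} (hQ : Q ≠ ⊥) : v ∈ Q := by
  obtain ⟨u, hu, hu0⟩ := (Submodule.ne_bot_iff Q).1 hQ
  obtain ⟨n, w, hw, hspan⟩ := h.exists_pow_smul_eq hu0
  have hwQ : w ∈ Q := (Submodule.span_singleton_le_iff_mem _ _).2 hu
    (hspan ▸ Submodule.mem_span_singleton_self w)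
  exact hw ▸ Q.smul_mem _ hwQ

theorem isIndecomposable (h : IsUniserialAt p v) : KroneckerAlgebra.IsIndecomposable S P := by
  refine ⟨⟨v, 0, h.ne_zero⟩, fun A B hAB => or_iff_not_imp_left.2 fun hA => ?_⟩
  by_contra hB
  exact h.ne_zero (Submodule.disjoint_def.1 hAB.disjoint v (h.mem_of_ne_bot hA)
    (h.mem_of_ne_bot hB))

theorem exists_of_iSup_eq_top {ι : Type*} [Nonempty ι] {Q : ι → Submodule S P}
    (hdir : Directed (· ≤ ·) Q) (htop : ⨆ i, Q i = ⊤) (h : ∀ i, ∃ v : Q i, IsUniserialAt p v) :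
    ∃ v : P, IsUniserialAt p v := by
  choose v hv using h
  obtain ⟨i₀⟩ := ‹Nonempty ι›
  have hmem (u : P) : ∃ i, Q i₀ ≤ Q i ∧ u ∈ Q i := by
    obtain ⟨i, hi⟩ := (Submodule.mem_iSup_of_directed Q hdir).1 (htop ▸ Submodule.mem_top (x := u))
    obtain ⟨j, h₀, hij⟩ := hdir i₀ i
    exact ⟨j, h₀, hij hi⟩
  refine ⟨v i₀, fun u => ?_, fun h0 => (hv i₀).ne_zero (Subtype.ext h0), le_antisymm ?_ ?_⟩
  · obtain ⟨i, -, hu⟩ := hmem u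
    exact ((hv i).torsion ⟨u, hu⟩).imp fun _ hn => congrArg Subtype.val hn
  · intro u hpu
    obtain ⟨i, hle, hu⟩ := hmem u
    have hu' : (⟨u, hu⟩ : Q i) ∈ Submodule.span S {v i} :=
      (hv i).torsionBy_eq_span ▸ Subtype.ext hpu
    have hv' : v i ∈ Submodule.span S {(⟨v i₀, hle (v i₀).2⟩ : Q i)} :=
      (hv i).mem_of_ne_bot fun hbot => (hv i₀).ne_zero <| Subtype.ext <|
        (Submodule.mk_eq_zero _ _).1 (Submodule.span_singleton_eq_bot.1 hbot)
    have hu'' := (Submodule.span_singleton_le_iff_mem _ _).2 hv' hu'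
    simpa [Submodule.map_span] using Submodule.mem_map_of_mem (f := (Q i).subtype) hu''
  · exact (Submodule.span_singleton_le_iff_mem _ _).2 (congrArg Subtype.val (hv i₀).smul_eq_zero)

theorem map_mem_span_singleton (h : IsUniserialAt p v) (φ : Module.End S P) (u : P) :
    φ u ∈ Submodule.span S {u} := by
  rcases eq_or_ne u 0 with rfl | hu
  · rw [map_zero]
    exact Submodule.zero_mem _
  obtain ⟨n, w, hw, hspan⟩ := h.exists_pow_smul_eq hu
  have hpu : u ∈ Submodule.torsionBy S P (p ^ (n + 1)) := by
    rw [h.torsionBy_pow_succ_eq_span hw, hspan]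
    exact Submodule.mem_span_singleton_self u
  rw [← hspan, ← h.torsionBy_pow_succ_eq_span hw, Submodule.mem_torsionBy_iff, ← map_smul,
    (Submodule.mem_torsionBy_iff _ _).1 hpu, map_zero]

theorem exists_span_singleton_eq_top_or_surjective (h : IsUniserialAt p v) :
    (∃ u : P, Submodule.span S {u} = ⊤) ∨ Function.Surjective fun u : P => p • u := by
  rw [or_iff_not_imp_right, Function.Surjective]
  push Not
  rintro ⟨u, hu⟩
  obtain ⟨n, w, hw, hspan⟩ := h.exists_pow_smul_eq (u := u) fun h0 => hu 0 (by rw [smul_zero, h0])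
  refine ⟨u, (Submodule.eq_top_iff').2 fun x => ?_⟩
  rcases eq_or_ne x 0 with rfl | hx
  · exact Submodule.zero_mem _
  obtain ⟨m, y, hy, hspan'⟩ := h.exists_pow_smul_eq hx
  rcases le_or_gt m n with hmn | hnm
  · have hle := Submodule.torsionBy_le_torsionBy_of_dvd (M := P) (p ^ (m + 1)) (p ^ (n + 1))
      (pow_dvd_pow p (Nat.succ_le_succ hmn))
    rw [h.torsionBy_pow_succ_eq_span hw, h.torsionBy_pow_succ_eq_span hy, hspan, hspan'] at hle
    exact hle (Submodule.mem_span_singleton_self x)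
  · have hpow : p ^ n • p ^ (m - n) • y = v := by
      rw [← mul_smul, ← pow_add, Nat.add_sub_cancel' hnm.le, hy]
    have hmem := Submodule.mem_span_singleton_self (R := S) u
    rw [← hspan, ← h.torsionBy_pow_succ_eq_span hw, h.torsionBy_pow_succ_eq_span hpow] at hmem
    obtain ⟨f, hf⟩ := Submodule.mem_span_singleton.1 hmem
    refine absurd ?_ (hu (f • p ^ (m - n - 1) • y))
    rw [← hf, smul_comm, ← mul_smul p, ← pow_succ', Nat.sub_add_cancel (by omega)]

/-- The endomorphisms of a uniserial module act locally as scalars. -/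
noncomputable abbrev endCommRing (h : IsUniserialAt p v) : CommRing (Module.End S P) where
  mul_comm φ ψ := LinearMap.ext fun u => by
    obtain ⟨f, hf⟩ := Submodule.mem_span_singleton.1 (h.map_mem_span_singleton φ u)
    obtain ⟨g, hg⟩ := Submodule.mem_span_singleton.1 (h.map_mem_span_singleton ψ u)
    rw [Module.End.mul_apply, Module.End.mul_apply, ← hf, ← hg, map_smul, map_smul, ← hf, ← hg,
      smul_comm]

end Chain

end IsUniserialAt

section Divisible

variable {S P : Type*} [CommRing S] [AddCommGroup P] [Module S P] {p : S} {v : P}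

theorem surjective_pow_smul (hp : Function.Surjective fun u : P => p • u) (n : ℕ) :
    Function.Surjective fun u : P => p ^ n • u := by
  rw [← smul_iterate]
  exact hp.iterate n

theorem exists_smul_eq_of_torsionBy_le_ker {φ : Module.End S P}
    (hp : Function.Surjective fun u : P => p • u)
    (hφ : Submodule.torsionBy S P p ≤ LinearMap.ker φ) :
    ∃ ψ : Module.End S P, p • ψ = φ := by
  refine ⟨(LinearMap.ker (LinearMap.lsmul S P p)).liftQ φ hφ ∘ₗ
    ((LinearMap.lsmul S P p).quotKerEquivOfSurjective hp).symm, LinearMap.ext fun u => ?_⟩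
  rw [LinearMap.smul_apply, ← map_smul]
  have hu : p • u = (LinearMap.lsmul S P p).quotKerEquivOfSurjective hp (Submodule.mkQ _ u) := rfl
  rw [LinearMap.comp_apply, hu, LinearEquiv.coe_coe, LinearEquiv.symm_apply_apply]
  exact Submodule.liftQ_apply _ _ _

theorem exists_end_of_locally_eventually_const (htors : ∀ u : P, ∃ n : ℕ, p ^ n • u = 0)
    (φ : ℕ → Module.End S P) (hφ : ∀ {m n : ℕ}, m ≤ n → ∀ u : P, p ^ m • u = 0 → φ m u = φ n u) :
    ∃ ψ : Module.End S P, ∀ (n : ℕ) (u : P), p ^ n • u = 0 → φ n u = ψ u := by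
  choose N hN using htors
  have hψ (n : ℕ) (u : P) (hu : p ^ n • u = 0) : φ n u = φ (N u) u :=
    (le_total n (N u)).elim (fun h => hφ h u hu) fun h => (hφ h u (hN u)).symm
  have hpow {m n : ℕ} (hmn : m ≤ n) {u : P} (hu : p ^ m • u = 0) : p ^ n • u = 0 := by
    rw [← Nat.sub_add_cancel hmn, pow_add, mul_smul, hu, smul_zero]
  refine ⟨{ toFun u := φ (N u) u, map_add' := fun u u' => ?_, map_smul' := fun f u => ?_ }, hψ⟩
  · have hu := hpow (le_max_left (N u) (N u')) (hN u)
    have hu' := hpow (le_max_right (N u) (N u')) (hN u')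
    rw [← hψ _ u hu, ← hψ _ u' hu', ← hψ _ (u + u') (by rw [smul_add, hu, hu', add_zero]), map_add]
  · rw [← hψ (N u) (f • u) (by rw [smul_comm, hN, smul_zero]), map_smul, RingHom.id_apply]

end Divisible

namespace IsUniserialAt

variable {S P : Type*} [CommRing S] [AddCommGroup P] [Module S P] {p : S} {v : P}
  [hp : (Ideal.span {p}).IsMaximal]

theorem mem_span_pow_iff (h : IsUniserialAt p v) (hdiv : Function.Surjective fun u : P => p • u)
    (n : ℕ) (φ : Module.End S P) : letI := h.endCommRing
    φ ∈ Ideal.span {algebraMap S (Module.End S P) p} ^ n ↔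
      ∀ u : P, p ^ n • u = 0 → φ u = 0 := by
  let := h.endCommRing
  rw [Ideal.span_singleton_pow, Ideal.mem_span_singleton, ← map_pow]
  constructor
  · rintro ⟨ψ, rfl⟩ u hu
    rw [Module.End.mul_apply, Module.algebraMap_end_apply, ← map_smul, hu, map_zero]
  · intro hφ
    obtain ⟨ψ, hψ⟩ := exists_smul_eq_of_torsionBy_le_ker (surjective_pow_smul hdiv n)
      (fun u hu => hφ u hu)
    exact ⟨ψ, by rw [← Algebra.smul_def, hψ]⟩

theorem isAdicComplete_end (h : IsUniserialAt p v)
    (hdiv : Function.Surjective fun u : P => p • u) : letI := h.endCommRing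
    IsAdicComplete (Ideal.span {algebraMap S (Module.End S P) p}) (Module.End S P) := by
  let := h.endCommRing
  have hmod (n : ℕ) (φ ψ : Module.End S P) :
      φ ≡ ψ [SMOD (Ideal.span {algebraMap S (Module.End S P) p} ^ n • ⊤ :
        Submodule (Module.End S P) (Module.End S P))] ↔ ∀ u : P, p ^ n • u = 0 → φ u = ψ u := by
    rw [SModEq.sub_mem, smul_eq_mul, Ideal.mul_top, h.mem_span_pow_iff hdiv]
    simp only [LinearMap.sub_apply, sub_eq_zero]
  refine { haus' := fun φ hφ => LinearMap.ext fun u => ?_, prec' := fun φ hφ => ?_ }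
  · obtain ⟨n, hn⟩ := h.torsion u
    exact (hmod n φ 0).1 (hφ n) u hn
  · obtain ⟨ψ, hψ⟩ := exists_end_of_locally_eventually_const h.torsion φ
      fun hmn => (hmod _ _ _).1 (hφ hmn)
    exact ⟨ψ, fun n => (hmod n _ _).2 (hψ n)⟩

theorem nonempty_quot_ringEquiv (h : IsUniserialAt p v)
    (hdiv : Function.Surjective fun u : P => p • u) : letI := h.endCommRing
    Nonempty (S ⧸ Ideal.span {p} ≃+*
      Module.End S P ⧸ Ideal.span {algebraMap S (Module.End S P) p}) := by
  let := h.endCommRing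
  let π : S →+* Module.End S P ⧸ Ideal.span {algebraMap S (Module.End S P) p} :=
    (Ideal.Quotient.mk _).comp (algebraMap S (Module.End S P))
  have hv (φ : Module.End S P) :
      φ ∈ Ideal.span {algebraMap S (Module.End S P) p} ↔ φ v = 0 := by
    rw [← pow_one (Ideal.span _), h.mem_span_pow_iff hdiv, pow_one]
    refine ⟨fun hφ => hφ v h.smul_eq_zero, fun hφ u hu => ?_⟩
    rw [← Submodule.mem_torsionBy_iff, h.torsionBy_eq_span] at hu
    obtain ⟨f, rfl⟩ := Submodule.mem_span_singleton.1 hu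
    rw [map_smul, hφ, smul_zero]
  have hker : RingHom.ker π = Ideal.span {p} := by
    ext f
    rw [RingHom.mem_ker, RingHom.comp_apply, Ideal.Quotient.eq_zero_iff_mem, hv,
      Module.algebraMap_end_apply, ← Ideal.mem_torsionOf_iff,
      torsionOf_eq_span h.ne_zero h.smul_eq_zero]
  have hsurj : Function.Surjective π := by
    intro x
    obtain ⟨φ, rfl⟩ := Ideal.Quotient.mk_surjective x
    obtain ⟨f, hf⟩ := Submodule.mem_span_singleton.1 (h.map_mem_span_singleton φ v)
    refine ⟨f, Ideal.Quotient.eq.2 ((hv _).2 ?_)⟩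
    rw [LinearMap.sub_apply, Module.algebraMap_end_apply, hf, sub_self]
  exact ⟨(Ideal.quotEquivOfEq hker.symm).trans (RingHom.quotientKerEquivOfSurjective hsurj)⟩

theorem nonempty_end_ringEquiv_powerSeries (F : Type*) {K : Type*} [Field F] [Algebra F S]
    [CommRing K] (h : IsUniserialAt p v) (hdiv : Function.Surjective fun u : P => p • u)
    (e : K ≃+* S ⧸ Ideal.span {p}) : Nonempty (Module.End S P ≃+* PowerSeries K) := by
  let := h.endCommRing
  let : Algebra F (Module.End S P) :=
    ((algebraMap S (Module.End S P)).comp (algebraMap F S)).toAlgebra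
  have hcomplete := h.isAdicComplete_end hdiv
  obtain ⟨e'⟩ := h.nonempty_quot_ringEquiv hdiv
  have hmax : (Ideal.span {algebraMap S (Module.End S P) p}).IsMaximal :=
    Ideal.Quotient.maximal_of_isField _ (e'.symm.toMulEquiv.isField
      ((Ideal.Quotient.maximal_ideal_iff_isField_quotient _).1 hp))
  have hnzd : algebraMap S (Module.End S P) p ∈ nonZeroDivisors (Module.End S P) := by
    refine mem_nonZeroDivisors_iff_right.2 fun φ hφ => LinearMap.ext fun u => ?_
    obtain ⟨u, rfl⟩ := hdiv u
    exact LinearMap.congr_fun hφ u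
  exact nonempty_ringEquiv_powerSeries_of_isAdicComplete F hnzd (e.trans e')

end IsUniserialAt

section AwayModSelf

variable {S : Type u} [CommRing S]

/-- The `p`-primary module `S[1/p] / S`. -/
abbrev AwayModSelf (p : S) : Type u :=
  Localization.Away p ⧸ LinearMap.range (Algebra.linearMap S (Localization.Away p))

namespace AwayModSelf

variable {p : S}

/-- The projection of `S[1/p]` onto `S[1/p] / S`. -/
noncomputable abbrev mk (p : S) : Localization.Away p →ₗ[S] AwayModSelf p :=
  Submodule.mkQ _

theorem mk_eq_zero_iff {x : Localization.Away p} :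
    mk p x = 0 ↔ ∃ s, algebraMap S (Localization.Away p) s = x := by
  rw [Submodule.mkQ_apply, Submodule.Quotient.mk_eq_zero]
  rfl

theorem smul_mk_invSelf_mul (x : Localization.Away p) :
    p • mk p (IsLocalization.Away.invSelf p * x) = mk p x := by
  rw [← map_smul, Algebra.smul_def, ← mul_assoc, IsLocalization.Away.mul_invSelf, one_mul]

theorem surjective_smul : Function.Surjective fun u : AwayModSelf p => p • u := fun u => by
  obtain ⟨x, rfl⟩ := Submodule.mkQ_surjective _ u
  exact ⟨_, smul_mk_invSelf_mul x⟩

theorem isUniserialAt (hp : p ∈ nonZeroDivisors S) (hp' : ¬IsUnit p) :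
    IsUniserialAt p (mk p (IsLocalization.Away.invSelf p)) where
  torsion u := by
    obtain ⟨x, rfl⟩ := Submodule.mkQ_surjective _ u
    obtain ⟨n, s, hs⟩ := IsLocalization.Away.surj p x
    exact ⟨n, by rw [← map_smul, mk_eq_zero_iff, Algebra.smul_def, map_pow, mul_comm, hs]; use s⟩
  ne_zero h0 := by
    obtain ⟨s, hs⟩ := mk_eq_zero_iff.1 h0
    have hinj : Function.Injective (algebraMap S (Localization.Away p)) :=
      IsLocalization.injective _ (Submonoid.powers_le.2 hp)
    refine hp' (IsUnit.of_mul_eq_one s (hinj ?_))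
    rw [map_mul, map_one, hs, IsLocalization.Away.mul_invSelf]
  torsionBy_eq_span := by
    refine le_antisymm (fun u hu => ?_) ?_
    · obtain ⟨x, rfl⟩ := Submodule.mkQ_surjective _ u
      obtain ⟨s, hs⟩ := mk_eq_zero_iff.1 ((map_smul (mk p) p x).trans hu)
      refine Submodule.mem_span_singleton.2 ⟨s, ?_⟩
      rw [← map_smul, Algebra.smul_def, hs, Algebra.smul_def, mul_right_comm,
        IsLocalization.Away.mul_invSelf, one_mul]
    · rw [Submodule.span_singleton_le_iff_mem, Submodule.mem_torsionBy_iff,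
        ← mul_one (IsLocalization.Away.invSelf p), smul_mk_invSelf_mul, mk_eq_zero_iff]
      exact ⟨1, map_one _⟩

end AwayModSelf

end AwayModSelf

namespace KroneckerAlgebra

section Arrow

/-- The element of the Kronecker algebra that acts as an arrow of the quiver: as `β` for `true` and
as `α` for `false`. -/
def arrow (k : Type u) [Field k] (b : Bool) : KroneckerAlgebra k :=
  bif b then ⟨0, 0, 1, 0⟩ else ⟨0, 1, 0, 0⟩

variable {k : Type u} [Field k]

theorem e₁_add_e₂ : e₁ k + e₂ k = 1 := by ext <;> simp [e₁, e₂]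

theorem e₂_mul_e₂ : e₂ k * e₂ k = e₂ k := by ext <;> simp [e₂]

theorem e₁_mul_e₂ : e₁ k * e₂ k = 0 := by ext <;> simp [e₁, e₂]

theorem e₁_mul_arrow (b : Bool) : e₁ k * arrow k b = arrow k b := by
  cases b <;> ext <;> simp [e₁, arrow]

theorem e₂_mul_arrow (b : Bool) : e₂ k * arrow k b = 0 := by
  cases b <;> ext <;> simp [e₂, arrow]

theorem arrow_mul_e₂ (b : Bool) : arrow k b * e₂ k = arrow k b := by
  cases b <;> ext <;> simp [e₂, arrow]

theorem arrow_mul_arrow (b c : Bool) : arrow k b * arrow k c = 0 := by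
  cases b <;> cases c <;> ext <;> simp [arrow]

theorem eq_smul_one_add_smul_e₂_add_smul_arrow (r : KroneckerAlgebra k) :
    r = r.a • 1 + (r.b - r.a) • e₂ k + r.c • arrow k false + r.d • arrow k true := by
  ext <;> simp [e₂, arrow]

theorem e₁_smul_add_e₂_smul {M : Type v} [AddCommGroup M] [Module (KroneckerAlgebra k) M] (m : M) :
    e₁ k • m + e₂ k • m = m := by
  rw [← add_smul, e₁_add_e₂, one_smul]

variable {M : Type v} {M' : Type w} [AddCommGroup M] [AddCommGroup M'] [Module k M] [Module k M']
  [Module (KroneckerAlgebra k) M] [Module (KroneckerAlgebra k) M']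
  [IsScalarTower k (KroneckerAlgebra k) M] [IsScalarTower k (KroneckerAlgebra k) M']

/-- A linear map that commutes with `e₂` and with both arrows is linear over the Kronecker
algebra. -/
def linearMapOfCommute (f : M →ₗ[k] M') (he₂ : ∀ m, f (e₂ k • m) = e₂ k • f m)
    (harrow : ∀ b m, f (arrow k b • m) = arrow k b • f m) : M →ₗ[KroneckerAlgebra k] M' where
  __ := f
  map_smul' r m := by
    rw [eq_smul_one_add_smul_e₂_add_smul_arrow r]
    simp [add_smul, smul_assoc, he₂, harrow]

end Arrow

section Defect

variable {k : Type u} [Field k] {M : Type v} {M' : Type w} [AddCommGroup M] [AddCommGroup M']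
  [Module k M] [Module k M'] [Module (KroneckerAlgebra k) M] [Module (KroneckerAlgebra k) M']
  [IsScalarTower k (KroneckerAlgebra k) M] [IsScalarTower k (KroneckerAlgebra k) M']

theorem finrank_cornerSpace_congr (f : M ≃ₗ[KroneckerAlgebra k] M') (e : KroneckerAlgebra k) :
    Module.finrank k (cornerSpace k M e) = Module.finrank k (cornerSpace k M' e) := by
  have hmap : (cornerSpace k M e).map (f.restrictScalars k : M →ₗ[k] M') = cornerSpace k M' e := by
    rw [cornerSpace, cornerSpace, ← LinearMap.range_comp,
      ← LinearMap.range_comp_of_range_eq_top (Algebra.lsmul k k M' e)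
        (f.restrictScalars k).range]
    congr 1
    ext m
    exact f.map_smul e m
  exact (LinearEquiv.ofSubmodules (f.restrictScalars k) _ _ hmap).finrank_eq

theorem defect_congr (f : M ≃ₗ[KroneckerAlgebra k] M') : defect k M = defect k M' := by
  simp only [defect, finrank_cornerSpace_congr f]

theorem finrank_cornerSpace_prod [Module.Finite k M] [Module.Finite k M']
    (e : KroneckerAlgebra k) : Module.finrank k (cornerSpace k (M × M') e) =
      Module.finrank k (cornerSpace k M e) + Module.finrank k (cornerSpace k M' e) := by
  have hprod : cornerSpace k (M × M') e =
      LinearMap.range ((cornerSpace k M e).subtype.prodMap (cornerSpace k M' e).subtype) := by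
    rw [LinearMap.range_prodMap, Submodule.range_subtype, Submodule.range_subtype]
    exact LinearMap.range_prodMap (Algebra.lsmul k k M e) (Algebra.lsmul k k M' e)
  rw [hprod, LinearMap.finrank_range_of_inj, Module.finrank_prod]
  exact Subtype.val_injective.prodMap Subtype.val_injective

theorem finite_submodule [Module.Finite k M] (N : Submodule (KroneckerAlgebra k) M) :
    Module.Finite k N :=
  Module.Finite.of_injective (N.subtype.restrictScalars k) N.subtype_injective

theorem defect_of_isCompl [Module.Finite k M] {A B : Submodule (KroneckerAlgebra k) M}
    (h : IsCompl A B) : defect k M = defect k A + defect k B := by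
  have := finite_submodule A
  have := finite_submodule B
  rw [← defect_congr (A.prodEquivOfIsCompl B h), defect, finrank_cornerSpace_prod,
    finrank_cornerSpace_prod, defect, defect]
  push_cast
  ring

/-- The action of an arrow as a linear map from the space at its source to the space at its
target. -/
def cornerMap (k : Type u) [Field k] (M : Type v) [AddCommGroup M] [Module k M]
    [Module (KroneckerAlgebra k) M] [IsScalarTower k (KroneckerAlgebra k) M] (b : Bool) :
    cornerSpace k M (e₂ k) →ₗ[k] cornerSpace k M (e₁ k) :=
  (Algebra.lsmul k k M (arrow k b)).restrict fun m _ =>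
    ⟨arrow k b • m, by simp only [Algebra.lsmul_coe, ← mul_smul, e₁_mul_arrow]⟩

variable {b : Bool}

theorem injective_cornerMap_iff : Function.Injective (cornerMap k M b) ↔
    ∀ m : M, arrow k b • m = 0 → e₂ k • m = 0 := by
  rw [injective_iff_map_eq_zero]
  constructor
  · intro h m hm
    refine congrArg Subtype.val (h ⟨e₂ k • m, m, rfl⟩ (Subtype.ext ?_))
    change arrow k b • e₂ k • m = 0
    rw [← mul_smul, arrow_mul_e₂, hm]
  · rintro h ⟨_, m, rfl⟩ hm
    have hm : arrow k b • e₂ k • m = 0 := congrArg Subtype.val hm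
    rw [← mul_smul, arrow_mul_e₂] at hm
    exact Subtype.ext (h m hm)

theorem surjective_cornerMap_iff : Function.Surjective (cornerMap k M b) ↔
    ∀ m : M, ∃ n : M, arrow k b • n = e₁ k • m := by
  constructor
  · intro h m
    obtain ⟨n, hn⟩ := h ⟨e₁ k • m, m, rfl⟩
    exact ⟨n, congrArg Subtype.val hn⟩
  · rintro h ⟨_, m, rfl⟩
    obtain ⟨n, hn⟩ := h m
    refine ⟨⟨e₂ k • n, n, rfl⟩, Subtype.ext ?_⟩
    change arrow k b • e₂ k • n = e₁ k • m
    rw [← mul_smul, arrow_mul_e₂, hn]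

theorem injective_cornerMap_of_injective (h : Function.Injective (cornerMap k M' b))
    {f : M →ₗ[KroneckerAlgebra k] M'} (hf : Function.Injective f) :
    Function.Injective (cornerMap k M b) := by
  rw [injective_cornerMap_iff] at h ⊢
  intro m hm
  apply hf
  rw [map_smul, map_zero, h _ (by rw [← map_smul, hm, map_zero])]

theorem surjective_cornerMap_of_surjective (h : Function.Surjective (cornerMap k M b))
    {f : M →ₗ[KroneckerAlgebra k] M'} (hf : Function.Surjective f) :
    Function.Surjective (cornerMap k M' b) := by
  rw [surjective_cornerMap_iff] at h ⊢
  intro m'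
  obtain ⟨m, rfl⟩ := hf m'
  obtain ⟨n, hn⟩ := h m
  exact ⟨f n, by rw [← map_smul, hn, map_smul]⟩

theorem defect_eq_zero_of_bijective_cornerMap (h : Function.Bijective (cornerMap k M b)) :
    defect k M = 0 := by
  rw [defect, (LinearEquiv.ofBijective _ h).finrank_eq, sub_self]

theorem surjective_cornerMap_of_defect_eq_zero [Module.Finite k M] (h0 : defect k M = 0)
    (h : Function.Injective (cornerMap k M b)) : Function.Surjective (cornerMap k M b) :=
  (LinearMap.injective_iff_surjective_of_finrank_eq_finrank
    (Nat.cast_injective (sub_eq_zero.1 h0))).1 h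

/-- Otherwise `m` would span a direct summand `k ⇉ 0`. -/
theorem IsIndecomposable.e₂_smul_eq_zero_of_arrow_smul_eq_zero [Module.Finite k M]
    (hM : IsIndecomposable (KroneckerAlgebra k) M) (h0 : defect k M = 0) {m : M}
    (hm : ∀ b, arrow k b • m = 0) : e₂ k • m = 0 := by
  by_contra hx
  set x := e₂ k • m with hxm
  have he₂ : e₂ k • x = x := by rw [hxm, ← mul_smul, e₂_mul_e₂]
  have harrow (b : Bool) : arrow k b • x = 0 := by rw [hxm, ← mul_smul, arrow_mul_e₂, hm]
  obtain ⟨l, hl⟩ := Module.Projective.exists_dual_eq_one k hx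
  let q : Module.End (KroneckerAlgebra k) M := linearMapOfCommute
    (LinearMap.toSpanSingleton k M x ∘ₗ l ∘ₗ Algebra.lsmul k k M (e₂ k))
    (fun m => by simp [← mul_smul, e₂_mul_e₂, smul_comm _ (l _), he₂])
    (fun b m => by simp [← mul_smul, e₂_mul_arrow, smul_comm _ (l _), harrow])
  have hq (m : M) : q m = l (e₂ k • m) • x := rfl
  have hqq (m : M) : q (q m) = q m := by simp [hq, smul_comm _ (l _), he₂, hl]
  rcases hM.2 _ _ (LinearMap.IsIdempotentElem.isCompl (f := q) (LinearMap.ext hqq)) with hbot | hbot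
  · have hqx : q x = x := by rw [hq, he₂, hl, one_smul]
    exact hx (by rw [← hqx, LinearMap.range_eq_bot.1 hbot, LinearMap.zero_apply])
  · have hq1 (m : M) : q m = m := LinearMap.ker_eq_bot.1 hbot (hqq m)
    have he₁ : cornerSpace k M (e₁ k) = ⊥ := by
      refine LinearMap.range_eq_bot.2 (LinearMap.ext fun m => ?_)
      change e₁ k • m = 0
      rw [← hq1 m, hq, smul_comm, ← he₂, ← mul_smul, e₁_mul_e₂, zero_smul, smul_zero]
    rw [defect, he₁, finrank_bot, Nat.cast_zero, sub_zero, Nat.cast_eq_zero,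
      Submodule.finrank_eq_zero] at h0
    exact hx ((Submodule.mem_bot k).1 (h0 ▸ ⟨m, rfl⟩))

end Defect

theorem isIndecomposable_congr {R : Type*} [Ring R] {M : Type v} {M' : Type w} [AddCommGroup M]
    [AddCommGroup M'] [Module R M] [Module R M'] (f : M ≃ₗ[R] M') (h : IsIndecomposable R M) :
    IsIndecomposable R M' := by
  refine ⟨f.symm.toEquiv.nontrivial_congr.2 h.1, fun A B hAB => ?_⟩
  simpa using h.2 _ _ ((Submodule.orderIsoMapComap f.symm).isCompl hAB)

section Regular

variable {k : Type u} [Field k] {M : Type v} {M' : Type w} [AddCommGroup M] [AddCommGroup M']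
  [Module k M] [Module k M'] [Module (KroneckerAlgebra k) M] [Module (KroneckerAlgebra k) M']
  [IsScalarTower k (KroneckerAlgebra k) M] [IsScalarTower k (KroneckerAlgebra k) M']

theorem finrank_pos_of_ne_bot [Module.Finite k M] {N : Submodule (KroneckerAlgebra k) M}
    (hN : N ≠ ⊥) : 0 < Module.finrank k N := by
  have := finite_submodule N
  have := Submodule.nontrivial_iff_ne_bot.2 hN
  exact Module.finrank_pos

theorem IsRegular.congr (f : M ≃ₗ[KroneckerAlgebra k] M') (h : IsRegular k M) :
    IsRegular k M' := by
  have := h.1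
  refine ⟨Module.Finite.equiv (f.restrictScalars k), fun A B hAB hA => ?_⟩
  rw [defect_congr (f.symm.submoduleMap A)]
  exact h.2 _ _ ((Submodule.orderIsoMapComap f.symm).isCompl hAB)
    (isIndecomposable_congr (f.symm.submoduleMap A) hA)

theorem IsRegular.of_isCompl {A B : Submodule (KroneckerAlgebra k) M} (hAB : IsCompl A B)
    (h : IsRegular k M) : IsRegular k A := by
  have := h.1
  refine ⟨finite_submodule A, fun C D hCD hC => ?_⟩
  let g := Submodule.equivMapOfInjective A.subtype A.subtype_injective C
  rw [defect_congr g]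
  refine h.2 _ (D.map A.subtype ⊔ B) ?_ (isIndecomposable_congr g hC)
  have hsup : C.map A.subtype ⊔ D.map A.subtype = A := by
    rw [← Submodule.map_sup, hCD.sup_eq_top, Submodule.map_subtype_top]
  have hinf : C.map A.subtype ⊓ D.map A.subtype = ⊥ := by
    rw [← Submodule.map_inf _ A.subtype_injective, hCD.inf_eq_bot, Submodule.map_bot]
  refine ⟨(disjoint_iff.2 hinf).disjoint_sup_right_of_disjoint_sup_left ?_, ?_⟩
  · rw [hsup]
    exact hAB.disjoint
  · rw [codisjoint_iff, ← sup_assoc, hsup, hAB.sup_eq_top]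

theorem IsRegular.defect_eq_zero (h : IsRegular k M) : defect k M = 0 := by
  have := h.1
  induction hn : Module.finrank k M using Nat.strong_induction_on generalizing M with
  | _ n ih =>
    by_cases hind : IsIndecomposable (KroneckerAlgebra k) M
    · rw [← defect_congr Submodule.topEquiv]
      exact h.2 ⊤ ⊥ isCompl_top_bot (isIndecomposable_congr Submodule.topEquiv.symm hind)
    rcases subsingleton_or_nontrivial M with _ | hM
    · rw [defect, Module.finrank_zero_of_subsingleton, Module.finrank_zero_of_subsingleton,
        sub_self]
    · obtain ⟨A, B, hAB, hA, hB⟩ : ∃ A B : Submodule (KroneckerAlgebra k) M,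
          IsCompl A B ∧ A ≠ ⊥ ∧ B ≠ ⊥ := by
        simpa [IsIndecomposable, hM] using hind
      have := finite_submodule A
      have := finite_submodule B
      have hdim := ((A.prodEquivOfIsCompl B hAB).restrictScalars k).finrank_eq
      rw [Module.finrank_prod] at hdim
      have hA := finrank_pos_of_ne_bot hA
      have hB := finrank_pos_of_ne_bot hB
      rw [defect_of_isCompl hAB, ih _ (by omega) (h.of_isCompl hAB) ‹_› rfl,
        ih _ (by omega) (h.of_isCompl hAB.symm) ‹_› rfl, add_zero]

theorem IsIndecomposable.isRegular [Module.Finite k M]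
    (h : IsIndecomposable (KroneckerAlgebra k) M) (h0 : defect k M = 0) : IsRegular k M := by
  refine ⟨‹_›, fun A B hAB hA => ?_⟩
  obtain rfl := (h.2 A B hAB).resolve_left (Submodule.nontrivial_iff_ne_bot.1 hA.1)
  obtain rfl : A = ⊤ := by simpa using hAB.sup_eq_top
  rw [defect_congr Submodule.topEquiv, h0]

theorem IsSimpleRegular.congr (f : M ≃ₗ[KroneckerAlgebra k] M') (h : IsSimpleRegular k M) :
    IsSimpleRegular k M' := by
  refine ⟨f.symm.toEquiv.nontrivial_congr.2 h.1, h.2.1.congr f, fun N hN => ?_⟩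
  refine (h.2.2 _ (hN.congr (f.symm.submoduleMap N))).imp (fun h => by simpa using h) fun h => ?_
  exact (map_eq_top_iff (Submodule.orderIsoMapComap f.symm)).1 h

theorem IsSimpleRegular.range_le_regularSocle (h : IsSimpleRegular k M)
    {f : M →ₗ[KroneckerAlgebra k] M'} (hf : Function.Injective f) :
    LinearMap.range f ≤ regularSocle k M' :=
  le_sSup (h.congr (LinearEquiv.ofInjective f hf))

theorem map_regularSocle_le {f : M →ₗ[KroneckerAlgebra k] M'} (hf : Function.Injective f) :
    (regularSocle k M).map f ≤ regularSocle k M' := by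
  rw [Submodule.map_le_iff_le_comap]
  refine sSup_le fun N hN => ?_
  rw [← Submodule.map_le_iff_le_comap]
  exact le_sSup (IsSimpleRegular.congr (Submodule.equivMapOfInjective f hf N) hN)

theorem map_regularSocle (f : M ≃ₗ[KroneckerAlgebra k] M') :
    (regularSocle k M).map (f : M →ₗ[KroneckerAlgebra k] M') = regularSocle k M' := by
  refine (map_regularSocle_le f.injective).antisymm ?_
  rw [Submodule.map_equiv_eq_comap_symm, ← Submodule.map_le_iff_le_comap]
  exact map_regularSocle_le f.symm.injective

theorem HasRegularLength.congr (f : M ≃ₗ[KroneckerAlgebra k] M') {n : ℕ}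
    (h : HasRegularLength k M n) : HasRegularLength k M' n := by
  obtain ⟨c, hc0, hcn, hc⟩ := h
  refine ⟨fun i => (c i).map (f : M →ₗ[KroneckerAlgebra k] M'), ?_, ?_, fun i hi =>
    ⟨Submodule.map_mono (hc i hi).1, (hc i hi).2.congr ?_⟩⟩
  · simp only [hc0, Submodule.map_bot]
  · simp only [hcn, Submodule.map_top, LinearEquiv.range]
  · refine Submodule.Quotient.equiv _ _ (f.submoduleMap (c (i + 1))) ?_
    ext x
    obtain ⟨y, rfl⟩ := (f.submoduleMap (c (i + 1))).surjective x
    simp [Submodule.submoduleOf]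

theorem HasRegularLength.le_finrank [Module.Finite k M] {n : ℕ} (h : HasRegularLength k M n) :
    n ≤ Module.finrank k M := by
  obtain ⟨c, -, -, hc⟩ := h
  have key (i : ℕ) (hi : i ≤ n) : i ≤ Module.finrank k ((c i).restrictScalars k) := by
    induction i with
    | zero => exact Nat.zero_le _
    | succ i ih =>
      obtain ⟨hle, hs⟩ := hc i hi
      have hlt : c i < c (i + 1) := hle.lt_of_ne fun heq => by
        have := hs.1
        rw [heq, Submodule.submoduleOf_self, Submodule.Quotient.nontrivial_iff] at this
        exact this rfl
      have := Submodule.finrank_lt_finrank_of_lt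
        (show (c i).restrictScalars k < (c (i + 1)).restrictScalars k from hlt)
      have := ih (by omega)
      omega
  exact (key n le_rfl).trans (Submodule.finrank_le _)

theorem IsRayModule.congr {U U' : Type*} [AddCommGroup U] [AddCommGroup U']
    [Module (KroneckerAlgebra k) U] [Module (KroneckerAlgebra k) U'] {n : ℕ}
    (f : M ≃ₗ[KroneckerAlgebra k] M') (g : U ≃ₗ[KroneckerAlgebra k] U')
    (h : IsRayModule k M U n) : IsRayModule k M' U' n := by
  obtain ⟨hind, hreg, hlen, ⟨s⟩⟩ := h
  exact ⟨isIndecomposable_congr f hind, hreg.congr f, hlen.congr f,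
    ⟨((f.ofSubmodules _ _ (map_regularSocle f)).symm.trans s).trans g⟩⟩

theorem IsPrufer.congr {U U' : Type*} [AddCommGroup U] [AddCommGroup U']
    [Module (KroneckerAlgebra k) U] [Module (KroneckerAlgebra k) U']
    (f : M ≃ₗ[KroneckerAlgebra k] M') (g : U ≃ₗ[KroneckerAlgebra k] U')
    (h : IsPrufer k M U) : IsPrufer k M' U' := by
  obtain ⟨c, hmono, htop, hc⟩ := h
  refine ⟨fun n => (c n).map (f : M →ₗ[KroneckerAlgebra k] M'),
    fun i j hij => Submodule.map_mono (hmono hij), ?_, fun n hn => ?_⟩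
  · rw [← Submodule.map_iSup, htop, Submodule.map_top, LinearEquiv.range]
  · exact (hc n hn).congr (f.submoduleMap (c n)) g

theorem IsPrufer.not_finite {U : Type*} [AddCommGroup U] [Module (KroneckerAlgebra k) U]
    (h : IsPrufer k M U) : ¬Module.Finite k M := fun _ => by
  obtain ⟨c, -, -, hc⟩ := h
  let n := Module.finrank k M + 1
  have := finite_submodule (c n)
  have hlen : n ≤ Module.finrank k (c n) := (hc n (Nat.le_add_left 1 _)).2.2.1.le_finrank
  exact absurd (hlen.trans (Submodule.finrank_le ((c n).restrictScalars k)))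
    (Nat.not_succ_le_self _)

end Regular

section PolynomialModule

variable {k : Type u} [Field k] {P : Type v} {P' : Type w} [AddCommGroup P] [AddCommGroup P']
  [Module k P] [Module k P'] [Module k[X] P] [Module k[X] P'] [IsScalarTower k k[X] P]
  [IsScalarTower k k[X] P']

/-- A linear map that commutes with the multiplication by `X` is `k[X]`-linear. -/
def linearMapOfCommuteX (f : P →ₗ[k] P') (h : ∀ x, f ((X : k[X]) • x) = (X : k[X]) • f x) :
    P →ₗ[k[X]] P' where
  __ := f
  map_smul' q x := by
    change f (q • x) = q • f x
    induction q using Polynomial.induction_on generalizing x with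
    | C a => rw [← algebraMap_eq, algebraMap_smul, algebraMap_smul, map_smul]
    | add q r hq hr => rw [add_smul, map_add, hq, hr, add_smul]
    | monomial n a ih => rw [pow_succ, ← mul_assoc, mul_smul, ih, h, ← mul_smul]

/-- A subspace that is stable under the multiplication by `X` is a `k[X]`-submodule. -/
def submoduleOfSMulX (Q : Submodule k P) (h : ∀ x ∈ Q, (X : k[X]) • x ∈ Q) :
    Submodule k[X] P where
  __ := Q
  smul_mem' q x hx := by
    change q • x ∈ Q
    change x ∈ Q at hx
    induction q using Polynomial.induction_on generalizing x with
    | C a => rw [← algebraMap_eq, algebraMap_smul]; exact Q.smul_mem a hx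
    | add q r hq hr => rw [add_smul]; exact Q.add_mem (hq x hx) (hr x hx)
    | monomial n a ih => rw [pow_succ, ← mul_assoc, mul_smul]; exact ih _ (h x hx)

end PolynomialModule

/-- The polynomial by which `α` acts in `PolyRep k b P`; there `β` acts by `coef k !b`. -/
noncomputable def coef (k : Type u) [Field k] (b : Bool) : k[X] := bif b then X else 1

/-- The representation on two copies of a `k[X]`-module `P` in which `arrow k b` acts as the
identity and the other arrow as the multiplication by `X`. -/
abbrev PolyRep (k : Type u) [Field k] (b : Bool) (P : Type v) [AddCommGroup P] [Module k P]
    [Module k[X] P] [IsScalarTower k k[X] P] : Type v :=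
  Rep (Algebra.lsmul k k P (coef k b)) (Algebra.lsmul k k P (coef k !b))

namespace PolyRep

section Basic

variable {k : Type u} [Field k] {b : Bool} {P : Type v} {P' : Type w} [AddCommGroup P]
  [AddCommGroup P'] [Module k P] [Module k P'] [Module k[X] P] [Module k[X] P']
  [IsScalarTower k k[X] P] [IsScalarTower k k[X] P']

/-- The element of `PolyRep k b P` with components `x` and `y` in the target and the source of the
arrows. -/
def mk (x y : P) : PolyRep k b P := ((x, y) : P × P)

@[simp] theorem mk_fst (x y : P) : (mk x y : PolyRep k b P).1 = x := rfl

@[simp] theorem mk_snd (x y : P) : (mk x y : PolyRep k b P).2 = y := rfl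

theorem ext {m n : PolyRep k b P} (h₁ : m.1 = n.1) (h₂ : m.2 = n.2) : m = n := Prod.ext h₁ h₂

theorem mk_add_mk (m : PolyRep k b P) : mk m.1 0 + mk 0 m.2 = m :=
  ext (add_zero m.1) (zero_add m.2)

theorem e₁_smul (m : PolyRep k b P) : e₁ k • m = mk m.1 0 := by
  refine ext ?_ ?_ <;> simp [e₁]

theorem e₂_smul (m : PolyRep k b P) : e₂ k • m = mk 0 m.2 := by
  refine ext ?_ ?_ <;> simp [e₂]

theorem arrow_smul (m : PolyRep k b P) : arrow k b • m = mk m.2 0 := by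
  refine ext ?_ ?_ <;> cases b <;> simp [arrow, coef]

theorem arrow_not_smul (m : PolyRep k b P) : arrow k (!b) • m = mk ((X : k[X]) • m.2) 0 := by
  refine ext ?_ ?_ <;> cases b <;> simp [arrow, coef]

theorem bijective_cornerMap : Function.Bijective (cornerMap k (PolyRep k b P) b) := by
  refine ⟨injective_cornerMap_iff.2 fun m hm => ?_, surjective_cornerMap_iff.2 fun m =>
    ⟨mk 0 m.1, by rw [arrow_smul, e₁_smul, mk_snd]⟩⟩
  rw [arrow_smul] at hm
  have hm2 : m.2 = 0 := congrArg Prod.fst hm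
  rw [e₂_smul, hm2]
  rfl

/-- The linear map on `PolyRep k b P` determined by its restriction to the source of the arrows. -/
noncomputable def lift {M : Type w} [AddCommGroup M] [Module k M] [Module (KroneckerAlgebra k) M]
    [IsScalarTower k (KroneckerAlgebra k) M] (g : P →ₗ[k] M) (he₂ : ∀ x, e₂ k • g x = g x)
    (hX : ∀ x, arrow k (!b) • g x = arrow k b • g ((X : k[X]) • x)) :
    PolyRep k b P →ₗ[KroneckerAlgebra k] M :=
  let f : PolyRep k b P →ₗ[k] M := (Algebra.lsmul k k M (arrow k b) ∘ₗ g).coprod g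
  have hf (m : PolyRep k b P) : f m = arrow k b • g m.1 + g m.2 := rfl
  linearMapOfCommute f
    (fun m => by simp [e₂_smul, hf, ← mul_smul, e₂_mul_arrow, he₂])
    (Bool.forall_bool' b |>.2
      ⟨fun m => by simp [arrow_smul, hf, ← mul_smul, arrow_mul_arrow],
        fun m => by simp [arrow_not_smul, hf, ← mul_smul, arrow_mul_arrow, hX]⟩)

variable {M : Type w} [AddCommGroup M] [Module k M] [Module (KroneckerAlgebra k) M]
  [IsScalarTower k (KroneckerAlgebra k) M] {g : P →ₗ[k] M} {he₂ : ∀ x, e₂ k • g x = g x}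
  {hX : ∀ x, arrow k (!b) • g x = arrow k b • g ((X : k[X]) • x)}

theorem lift_apply (m : PolyRep k b P) : lift g he₂ hX m = arrow k b • g m.1 + g m.2 := rfl

theorem lift_injective (hg : ∀ x, arrow k b • g x = 0 → x = 0) :
    Function.Injective (lift g he₂ hX) := by
  refine (injective_iff_map_eq_zero _).2 fun m hm => ?_
  have hsnd : g m.2 = 0 := by
    have := congrArg (e₂ k • ·) hm
    simpa [lift_apply, ← mul_smul, e₂_mul_arrow, he₂] using this
  refine ext (hg _ ?_) (hg _ (by rw [hsnd, smul_zero]))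
  simpa [lift_apply, hsnd] using hm

/-- Functoriality of `PolyRep`. -/
noncomputable def map (φ : P →ₗ[k[X]] P') :
    PolyRep k b P →ₗ[KroneckerAlgebra k] PolyRep k b P' where
  toFun m := mk (φ m.1) (φ m.2)
  map_add' m n := ext (map_add φ _ _) (map_add φ _ _)
  map_smul' r m := by
    have h (t : k) (x : P) : φ (t • x) = t • φ x := LinearMap.map_smul_of_tower φ t x
    refine ext ?_ ?_ <;> simp [h]

/-- Functoriality of `PolyRep` for isomorphisms. -/
noncomputable def mapEquiv (φ : P ≃ₗ[k[X]] P') :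
    PolyRep k b P ≃ₗ[KroneckerAlgebra k] PolyRep k b P' where
  __ := map φ.toLinearMap
  invFun := map φ.symm.toLinearMap
  left_inv _ := ext (φ.symm_apply_apply _) (φ.symm_apply_apply _)
  right_inv _ := ext (φ.apply_symm_apply _) (φ.apply_symm_apply _)

theorem map_surjective : Function.Surjective
    (map : (P →ₗ[k[X]] P') → PolyRep k b P →ₗ[KroneckerAlgebra k] PolyRep k b P') := by
  intro Φ
  let f : P →ₗ[k] P' := LinearMap.snd k P' P' ∘ₗ Φ.restrictScalars k ∘ₗ LinearMap.inr k P P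
  have hsnd (y : P) : Φ (mk 0 y) = mk 0 (f y) := by
    have : Φ (e₂ k • mk 0 y) = e₂ k • Φ (mk 0 y) := map_smul _ _ _
    rwa [e₂_smul, e₂_smul] at this
  have hfst (x : P) : Φ (mk x 0) = mk (f x) 0 := by
    have : Φ (arrow k b • mk 0 x) = arrow k b • Φ (mk 0 x) := map_smul _ _ _
    rwa [hsnd, arrow_smul, arrow_smul] at this
  have hX (x : P) : f ((X : k[X]) • x) = (X : k[X]) • f x := by
    have : Φ (arrow k (!b) • mk 0 x) = arrow k (!b) • Φ (mk 0 x) := map_smul _ _ _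
    rw [hsnd, arrow_not_smul, arrow_not_smul, mk_snd, mk_snd, hfst] at this
    exact congrArg Prod.fst this
  refine ⟨linearMapOfCommuteX f hX, LinearMap.ext fun m => ?_⟩
  conv_rhs => rw [← mk_add_mk m, map_add, hfst, hsnd]
  exact (mk_add_mk (mk (f m.1) (f m.2))).symm

/-- The endomorphism ring of `PolyRep k b P` is that of the `k[X]`-module `P`. -/
noncomputable def endRingEquiv (k : Type u) [Field k] (b : Bool) (P : Type v) [AddCommGroup P]
    [Module k P] [Module k[X] P] [IsScalarTower k k[X] P] :
    Module.End k[X] P ≃+* Module.End (KroneckerAlgebra k) (PolyRep k b P) :=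
  let F : Module.End k[X] P →+* Module.End (KroneckerAlgebra k) (PolyRep k b P) :=
    { toFun := map
      map_one' := rfl
      map_mul' _ _ := rfl
      map_zero' := rfl
      map_add' _ _ := rfl }
  RingEquiv.ofBijective F
    ⟨fun _ _ h => LinearMap.ext fun x => congrArg Prod.fst (LinearMap.congr_fun h (mk x 0)),
      map_surjective⟩

end Basic

section Sub

variable {k : Type u} [Field k] {b : Bool} {P : Type v} {P' : Type w} [AddCommGroup P]
  [AddCommGroup P'] [Module k P] [Module k P'] [Module k[X] P] [Module k[X] P']
  [IsScalarTower k k[X] P] [IsScalarTower k k[X] P']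

/-- The submodule of `PolyRep k b P` that corresponds to a `k[X]`-submodule of `P`. -/
def sub (b : Bool) (Q : Submodule k[X] P) : Submodule (KroneckerAlgebra k) (PolyRep k b P) where
  carrier := {m | m.1 ∈ Q ∧ m.2 ∈ Q}
  add_mem' h h' := ⟨Q.add_mem h.1 h'.1, Q.add_mem h.2 h'.2⟩
  zero_mem' := ⟨Q.zero_mem, Q.zero_mem⟩
  smul_mem' _ _ h :=
    ⟨Q.add_mem (Q.add_mem (Q.smul_of_tower_mem _ h.1)
      (Q.smul_of_tower_mem _ (Q.smul_mem _ h.2))) (Q.smul_of_tower_mem _ (Q.smul_mem _ h.2)),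
      Q.smul_of_tower_mem _ h.2⟩

theorem sub_le_sub_iff {Q Q' : Submodule k[X] P} : sub b Q ≤ sub b Q' ↔ Q ≤ Q' :=
  ⟨fun h x hx => (h (show mk x 0 ∈ sub b Q from ⟨hx, Q.zero_mem⟩)).1,
    fun h _ hm => ⟨h hm.1, h hm.2⟩⟩

theorem sub_injective : Function.Injective (sub b : Submodule k[X] P → _) := fun _ _ h =>
  le_antisymm (sub_le_sub_iff.1 h.le) (sub_le_sub_iff.1 h.ge)

@[simp] theorem sub_bot : sub b (⊥ : Submodule k[X] P) = ⊥ :=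
  eq_bot_iff.2 fun _ hm => ext hm.1 hm.2

@[simp] theorem sub_top : sub b (⊤ : Submodule k[X] P) = ⊤ :=
  eq_top_iff.2 fun _ _ => ⟨trivial, trivial⟩

theorem map_sub_map (φ : P →ₗ[k[X]] P') (Q : Submodule k[X] P) :
    (sub b Q).map (map φ) = sub b (Q.map φ) := by
  ext m
  constructor
  · rintro ⟨n, hn, rfl⟩
    exact ⟨⟨_, hn.1, rfl⟩, ⟨_, hn.2, rfl⟩⟩
  · rintro ⟨⟨x, hx, h₁⟩, ⟨y, hy, h₂⟩⟩
    exact ⟨mk x y, ⟨hx, hy⟩, ext h₁ h₂⟩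

theorem ker_map (φ : P →ₗ[k[X]] P') :
    LinearMap.ker (map φ : PolyRep k b P →ₗ[KroneckerAlgebra k] _) = sub b (LinearMap.ker φ) := by
  ext m
  exact ⟨fun h => ⟨congrArg Prod.fst h, congrArg Prod.snd h⟩, fun h => ext h.1 h.2⟩

theorem range_map (φ : P →ₗ[k[X]] P') :
    LinearMap.range (map φ : PolyRep k b P →ₗ[KroneckerAlgebra k] _) =
      sub b (LinearMap.range φ) := by
  rw [LinearMap.range_eq_map, LinearMap.range_eq_map, ← map_sub_map, sub_top]

theorem map_injective_of_injective {φ : P →ₗ[k[X]] P'} (hφ : Function.Injective φ) :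
    Function.Injective (map φ : PolyRep k b P →ₗ[KroneckerAlgebra k] _) := by
  rw [← LinearMap.ker_eq_bot, ker_map, LinearMap.ker_eq_bot.2 hφ, sub_bot]

/-- The submodule `sub b Q` is the representation on `Q`. -/
noncomputable def subEquiv (b : Bool) (Q : Submodule k[X] P) :
    PolyRep k b Q ≃ₗ[KroneckerAlgebra k] sub b Q :=
  (LinearEquiv.ofInjective (map Q.subtype) (map_injective_of_injective Q.subtype_injective)).trans
    (LinearEquiv.ofEq _ _ (by rw [range_map, Submodule.range_subtype]))

theorem isCompl_sub_iff {A B : Submodule k[X] P} : IsCompl (sub b A) (sub b B) ↔ IsCompl A B := by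
  have hinf : sub b (A ⊓ B) = sub b A ⊓ sub b B := by
    ext m
    exact and_and_and_comm
  have hsup : sub b (A ⊔ B) = sub b A ⊔ sub b B := by
    refine le_antisymm ?_ (sup_le (sub_le_sub_iff.2 le_sup_left) (sub_le_sub_iff.2 le_sup_right))
    rintro m ⟨h₁, h₂⟩
    obtain ⟨x₁, hx₁, y₁, hy₁, h₁⟩ := Submodule.mem_sup.1 h₁
    obtain ⟨x₂, hx₂, y₂, hy₂, h₂⟩ := Submodule.mem_sup.1 h₂
    exact Submodule.mem_sup.2 ⟨mk x₁ x₂, ⟨hx₁, hx₂⟩, mk y₁ y₂, ⟨hy₁, hy₂⟩, ext h₁ h₂⟩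
  rw [isCompl_iff, isCompl_iff, disjoint_iff, disjoint_iff, codisjoint_iff, codisjoint_iff,
    ← hinf, ← hsup, ← sub_bot, ← sub_top, sub_injective.eq_iff, sub_injective.eq_iff]

theorem exists_eq_sub (N : Submodule (KroneckerAlgebra k) (PolyRep k b P))
    (h : Function.Surjective (cornerMap k N b)) : ∃ Q, N = sub b Q := by
  have hsource (x : P) (hx : mk x 0 ∈ N) : mk 0 x ∈ N := by
    obtain ⟨⟨n, hn⟩, hnx⟩ := surjective_cornerMap_iff.1 h ⟨mk x 0, hx⟩
    have hnx : arrow k b • n = e₁ k • mk x 0 := congrArg Subtype.val hnx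
    rw [arrow_smul, e₁_smul] at hnx
    have hn2 : n.2 = x := congrArg Prod.fst hnx
    rw [← hn2, ← e₂_smul]
    exact N.smul_mem _ hn
  have htarget (x : P) (hx : mk 0 x ∈ N) : mk x 0 ∈ N := by
    simpa [arrow_smul] using N.smul_mem (arrow k b) hx
  have hX (x : P) (hx : mk 0 x ∈ N) : mk 0 ((X : k[X]) • x) ∈ N :=
    hsource _ (by simpa [arrow_not_smul] using N.smul_mem (arrow k !b) hx)
  let Q : Submodule k[X] P :=
    submoduleOfSMulX ((N.restrictScalars k).comap (LinearMap.inr k P P)) hX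
  refine ⟨Q, Submodule.ext fun m => ⟨fun hm => ⟨hsource _ ?_, ?_⟩, fun hm => ?_⟩⟩
  · simpa [e₁_smul] using N.smul_mem (e₁ k) hm
  · change mk 0 m.2 ∈ N
    simpa [e₂_smul] using N.smul_mem (e₂ k) hm
  · rw [← mk_add_mk m]
    exact N.add_mem (htarget _ hm.1) hm.2

end Sub

section Regular

variable {k : Type u} [Field k] {b : Bool} {P : Type v} [AddCommGroup P] [Module k P]
  [Module k[X] P] [IsScalarTower k k[X] P]

instance [Module.Finite k P] : Module.Finite k (PolyRep k b P) :=
  inferInstanceAs (Module.Finite k (P × P))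

theorem nontrivial_iff : Nontrivial (PolyRep k b P) ↔ Nontrivial P := by
  refine ⟨fun h => not_subsingleton_iff_nontrivial.1 fun _ => ?_, fun _ =>
    inferInstanceAs (Nontrivial (P × P))⟩
  exact not_subsingleton (PolyRep k b P) (inferInstanceAs (Subsingleton (P × P)))

theorem defect_eq_zero : defect k (PolyRep k b P) = 0 :=
  defect_eq_zero_of_bijective_cornerMap bijective_cornerMap

theorem exists_eq_sub_of_isCompl {A B : Submodule (KroneckerAlgebra k) (PolyRep k b P)}
    (h : IsCompl A B) : ∃ Q, A = sub b Q :=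
  exists_eq_sub A <| surjective_cornerMap_of_surjective bijective_cornerMap.2
    (Submodule.projectionOnto_surjective h)

theorem exists_eq_sub_of_isRegular {N : Submodule (KroneckerAlgebra k) (PolyRep k b P)}
    (h : IsRegular k N) : ∃ Q, N = sub b Q :=
  have := h.1
  exists_eq_sub N <| surjective_cornerMap_of_defect_eq_zero h.defect_eq_zero <|
    injective_cornerMap_of_injective bijective_cornerMap.1 N.subtype_injective

theorem isIndecomposable_iff :
    IsIndecomposable (KroneckerAlgebra k) (PolyRep k b P) ↔ IsIndecomposable k[X] P := by
  refine and_congr nontrivial_iff ⟨fun h A B hAB => ?_, fun h A B hAB => ?_⟩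
  · simpa only [← sub_bot, sub_injective.eq_iff] using h _ _ (isCompl_sub_iff.2 hAB)
  · obtain ⟨A, rfl⟩ := exists_eq_sub_of_isCompl hAB
    obtain ⟨B, rfl⟩ := exists_eq_sub_of_isCompl hAB.symm
    simpa only [← sub_bot, sub_injective.eq_iff] using h _ _ (isCompl_sub_iff.1 hAB)

theorem isRegular_of_isIndecomposable [Module.Finite k P] (h : IsIndecomposable k[X] P) :
    IsRegular k (PolyRep k b P) :=
  (isIndecomposable_iff.2 h).isRegular defect_eq_zero

theorem isSimpleRegular [Module.Finite k P] [IsSimpleModule k[X] P] :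
    IsSimpleRegular k (PolyRep k b P) := by
  have := IsSimpleModule.nontrivial k[X] P
  refine ⟨nontrivial_iff.2 this, isRegular_of_isIndecomposable ⟨this, fun A B hAB => ?_⟩,
    fun N hN => ?_⟩
  · refine (eq_bot_or_eq_top A).imp_right ?_
    rintro rfl
    simpa using hAB.disjoint
  · obtain ⟨Q, rfl⟩ := exists_eq_sub_of_isRegular hN
    refine (eq_bot_or_eq_top Q).imp ?_ ?_ <;> rintro rfl
    exacts [sub_bot, sub_top]

end Regular

end PolyRep

section PolynomialQuotient

variable {k : Type u} [Field k]

theorem finite_quotient_span_singleton {q : k[X]} (hq : q ≠ 0) :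
    Module.Finite k (k[X] ⧸ Ideal.span {q}) :=
  (AdjoinRoot.powerBasis hq).finite

theorem finite_of_span_singleton_eq_top {P : Type v} [AddCommGroup P] [Module k P] [Module k[X] P]
    [IsScalarTower k k[X] P] {q : k[X]} (hq : q ≠ 0) {w : P} (hqw : q • w = 0)
    (hw : Submodule.span k[X] {w} = ⊤) : Module.Finite k P := by
  have := finite_quotient_span_singleton hq
  let g : (k[X] ⧸ Ideal.span {q}) →ₗ[k[X]] P :=
    Submodule.liftQ _ (LinearMap.toSpanSingleton k[X] P w)
      ((Submodule.span_singleton_le_iff_mem _ _).2 hqw)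
  have hg : Function.Surjective g := LinearMap.range_eq_top.1 (by
    rw [Submodule.range_liftQ, LinearMap.range_toSpanSingleton, hw])
  exact Module.Finite.of_surjective (g.restrictScalars k) hg

theorem isSimpleRegular_polyRep_quotient {p : k[X]} [hmax : (Ideal.span {p}).IsMaximal]
    (hp : p ≠ 0) (b : Bool) : IsSimpleRegular k (PolyRep k b (k[X] ⧸ Ideal.span {p})) := by
  have := finite_quotient_span_singleton hp
  have : IsSimpleModule k[X] (k[X] ⧸ Ideal.span {p}) :=
    isSimpleModule_iff_quot_maximal.2 ⟨_, hmax, ⟨LinearEquiv.refl _ _⟩⟩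
  exact PolyRep.isSimpleRegular

end PolynomialQuotient

theorem IsSimpleRegular.eq_of_le {k : Type u} [Field k] {M : Type v} [AddCommGroup M] [Module k M]
    [Module (KroneckerAlgebra k) M] [IsScalarTower k (KroneckerAlgebra k) M]
    {N N' : Submodule (KroneckerAlgebra k) M} (hN : IsSimpleRegular k N) (hN' : IsRegular k N')
    (h0 : N' ≠ ⊥) (hle : N' ≤ N) : N' = N := by
  rcases hN.2.2 (N'.submoduleOf N) (hN'.congr (Submodule.submoduleOfEquivOfLe hle).symm) with h | h
  · exact absurd ((Submodule.disjoint_iff_comap_eq_bot.2 h).symm.eq_bot_of_le hle) h0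
  · exact hle.antisymm (Submodule.submoduleOf_eq_top.1 h)

section Uniserial

variable {k : Type u} [Field k] {b : Bool} {P : Type v} [AddCommGroup P] [Module k P]
  [Module k[X] P] [IsScalarTower k k[X] P] {p : k[X]} {v : P}
  [(Ideal.span {p}).IsMaximal]

/-- A nonzero element killed by `p` spans a copy of the simple regular representation. -/
noncomputable def quotientEquivSub (b : Bool) (hv0 : v ≠ 0) (hv : p • v = 0) :
    PolyRep k b (k[X] ⧸ Ideal.span {p}) ≃ₗ[KroneckerAlgebra k]
      PolyRep.sub b (Submodule.span k[X] {v}) :=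
  (PolyRep.mapEquiv (quotEquivSpanSingleton hv0 hv)).trans (PolyRep.subEquiv b _)

theorem regularSocle_polyRep (h : IsUniserialAt p v) (hp : p ≠ 0) :
    regularSocle k (PolyRep k b P) = PolyRep.sub b (Submodule.span k[X] {v}) := by
  have hsimple : IsSimpleRegular k (PolyRep.sub b (Submodule.span k[X] {v})) :=
    (isSimpleRegular_polyRep_quotient hp b).congr (quotientEquivSub b h.ne_zero h.smul_eq_zero)
  refine le_antisymm (sSup_le fun N hN => ?_) (le_sSup hsimple)
  obtain ⟨Q, rfl⟩ := PolyRep.exists_eq_sub_of_isRegular hN.2.1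
  have hQ : Q ≠ ⊥ := by
    rintro rfl
    exact Submodule.nontrivial_iff_ne_bot.1 hN.1 PolyRep.sub_bot
  refine (hN.eq_of_le hsimple.2.1 (Submodule.nontrivial_iff_ne_bot.1 hsimple.1) ?_).ge
  exact PolyRep.sub_le_sub_iff.2 ((Submodule.span_singleton_le_iff_mem _ _).2 (h.mem_of_ne_bot hQ))

theorem isSimpleRegular_sub_torsionBy_quotient (h : IsUniserialAt p v) (hp : p ≠ 0) {n : ℕ} {w : P}
    (hw : p ^ n • w = v) :
    IsSimpleRegular k (PolyRep.sub b (Submodule.torsionBy k[X] P (p ^ (n + 1))) ⧸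
      (PolyRep.sub b (Submodule.torsionBy k[X] P (p ^ n))).submoduleOf
        (PolyRep.sub b (Submodule.torsionBy k[X] P (p ^ (n + 1))))) := by
  let φ : PolyRep k b P →ₗ[KroneckerAlgebra k] PolyRep k b P :=
    PolyRep.map (LinearMap.lsmul k[X] P (p ^ n))
  let ψ := φ.domRestrict (PolyRep.sub b (Submodule.torsionBy k[X] P (p ^ (n + 1))))
  have hker : LinearMap.ker ψ = (PolyRep.sub b (Submodule.torsionBy k[X] P (p ^ n))).submoduleOf
      (PolyRep.sub b (Submodule.torsionBy k[X] P (p ^ (n + 1)))) := by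
    rw [LinearMap.ker_domRestrict, PolyRep.ker_map]
    rfl
  have hrange : LinearMap.range ψ = PolyRep.sub b (Submodule.span k[X] {v}) := by
    rw [LinearMap.range_domRestrict, PolyRep.map_sub_map, h.map_pow_smul_torsionBy hw]
  rw [← hker]
  exact (isSimpleRegular_polyRep_quotient hp b).congr <|
    (quotientEquivSub b h.ne_zero h.smul_eq_zero).trans <|
      (LinearEquiv.ofEq _ _ hrange.symm).trans ψ.quotKerEquivRange.symm

theorem isRayModule_polyRep (h : IsUniserialAt p v) (hp : p ≠ 0) {n : ℕ} {w : P}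
    (hw : p ^ n • w = v) (htop : Submodule.span k[X] {w} = ⊤) :
    IsRayModule k (PolyRep k b P) (PolyRep k b (k[X] ⧸ Ideal.span {p})) (n + 1) := by
  have hann : p ^ (n + 1) • w = 0 := by rw [pow_succ', mul_smul, hw, h.smul_eq_zero]
  have := finite_of_span_singleton_eq_top (pow_ne_zero _ hp) hann htop
  refine ⟨PolyRep.isIndecomposable_iff.2 h.isIndecomposable,
    PolyRep.isRegular_of_isIndecomposable h.isIndecomposable,
    ⟨fun i => PolyRep.sub b (Submodule.torsionBy k[X] P (p ^ i)), ?_, ?_, fun i hi => ⟨?_, ?_⟩⟩, ?_⟩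
  · simp only [pow_zero, Submodule.torsionBy_one, PolyRep.sub_bot]
  · simp only [h.torsionBy_pow_succ_eq_span hw, htop, PolyRep.sub_top]
  · exact PolyRep.sub_le_sub_iff.2
      (Submodule.torsionBy_le_torsionBy_of_dvd _ _ (pow_dvd_pow p i.le_succ))
  · refine isSimpleRegular_sub_torsionBy_quotient h hp (w := p ^ (n - i) • w) ?_
    rw [← mul_smul, ← pow_add, Nat.add_sub_cancel' (Nat.lt_succ_iff.1 hi), hw]
  · rw [regularSocle_polyRep h hp]
    exact ⟨(quotientEquivSub b h.ne_zero h.smul_eq_zero).symm⟩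

theorem isPrufer_polyRep (h : IsUniserialAt p v) (hp : p ≠ 0)
    (hdiv : Function.Surjective fun u : P => p • u) :
    IsPrufer k (PolyRep k b P) (PolyRep k b (k[X] ⧸ Ideal.span {p})) := by
  refine ⟨fun n => PolyRep.sub b (Submodule.torsionBy k[X] P (p ^ n)), ?_, ?_, fun n hn => ?_⟩
  · exact fun m n hmn => PolyRep.sub_le_sub_iff.2
      (Submodule.torsionBy_le_torsionBy_of_dvd _ _ (pow_dvd_pow p hmn))
  · refine eq_top_iff.2 fun m _ => ?_
    obtain ⟨i, hi⟩ := h.torsion m.1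
    obtain ⟨j, hj⟩ := h.torsion m.2
    refine Submodule.mem_iSup_of_mem (i + j) ⟨?_, ?_⟩ <;> rw [Submodule.mem_torsionBy_iff]
    · rw [pow_add, mul_comm, mul_smul, hi, smul_zero]
    · rw [pow_add, mul_smul, hj, smul_zero]
  · obtain ⟨n, rfl⟩ := Nat.exists_eq_add_of_le' hn
    obtain ⟨w, hw⟩ := surjective_pow_smul hdiv n v
    set Q := Submodule.torsionBy k[X] P (p ^ (n + 1)) with hQ
    rw [h.torsionBy_pow_succ_eq_span hw] at hQ
    have hwQ : w ∈ Q := hQ ▸ Submodule.mem_span_singleton_self w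
    have htop : Submodule.span k[X] {(⟨w, hwQ⟩ : Q)} = ⊤ := by
      apply Submodule.map_injective_of_injective Q.subtype_injective
      rw [Submodule.map_span, Set.image_singleton, Submodule.map_subtype_top]
      exact hQ.symm
    exact (isRayModule_polyRep (h.submodule (hw ▸ Q.smul_mem _ hwQ)) hp (Subtype.ext hw) htop).congr
      (PolyRep.subEquiv b Q) (.refl _ _)

end Uniserial

section CornerMap

variable {k : Type u} [Field k] {b : Bool} {M : Type v} [AddCommGroup M] [Module k M]
  [Module (KroneckerAlgebra k) M] [IsScalarTower k (KroneckerAlgebra k) M]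

theorem exists_polyRep_equiv (h : Function.Bijective (cornerMap k M b)) :
    ∃ (P : Type v) (_ : AddCommGroup P) (_ : Module k P) (_ : Module k[X] P)
      (_ : IsScalarTower k k[X] P), Nonempty (PolyRep k b P ≃ₗ[KroneckerAlgebra k] M) := by
  let A := LinearEquiv.ofBijective _ h
  let T : Module.End k (cornerSpace k M (e₂ k)) := A.symm.toLinearMap ∘ₗ cornerMap k M !b
  let g : Module.AEval' T →ₗ[k] M :=
    (cornerSpace k M (e₂ k)).subtype ∘ₗ (Module.AEval'.of T).symm.toLinearMap
  have he₂ (x) : e₂ k • g x = g x := by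
    obtain ⟨m, hm⟩ := ((Module.AEval'.of T).symm x).2
    change e₂ k • m = g x at hm
    rw [← hm, ← mul_smul, e₂_mul_e₂]
  have hX (x) : arrow k (!b) • g x = arrow k b • g ((X : k[X]) • x) := by
    obtain ⟨y, rfl⟩ := (Module.AEval'.of T).surjective x
    rw [Module.AEval'.X_smul_of]
    exact (congrArg Subtype.val (A.apply_symm_apply (cornerMap k M (!b) y))).symm
  refine ⟨Module.AEval' T, inferInstance, inferInstance, inferInstance, inferInstance,
    ⟨LinearEquiv.ofBijective (PolyRep.lift g he₂ hX) ⟨PolyRep.lift_injective fun x hx => ?_, ?_⟩⟩⟩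
  · have h0 := injective_cornerMap_iff.1 h.1 _ hx
    rw [he₂] at h0
    exact (Module.AEval'.of T).symm.map_eq_zero_iff.1 (Subtype.ext h0)
  · intro m
    obtain ⟨n, hn⟩ := surjective_cornerMap_iff.1 h.2 m
    refine ⟨PolyRep.mk (Module.AEval'.of T ⟨e₂ k • n, n, rfl⟩)
      (Module.AEval'.of T ⟨e₂ k • m, m, rfl⟩), ?_⟩
    change arrow k b • e₂ k • n + e₂ k • m = m
    rw [← mul_smul, arrow_mul_e₂, hn, e₁_smul_add_e₂_smul]

theorem X_smul_quotient_X_sub_C (c : k) (x : k[X] ⧸ Ideal.span {X - C c}) :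
    (X : k[X]) • x = c • x := by
  obtain ⟨f, rfl⟩ := Ideal.Quotient.mk_surjective x
  change Ideal.Quotient.mk (Ideal.span {X - C c}) (X * f) = Ideal.Quotient.mk _ (c • f)
  rw [Ideal.Quotient.eq, smul_eq_C_mul, ← sub_mul]
  exact Ideal.mul_mem_right f _ (Ideal.mem_span_singleton_self _)

/-- An element of the kernel that is not killed by the other arrow generates a copy of
`PolyRep k (!b) (k[X] ⧸ (X))`. -/
theorem injective_cornerMap_of_regularSocle [Module.Finite k M]
    (hM : IsIndecomposable (KroneckerAlgebra k) M) (h0 : defect k M = 0)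
    (h : Function.Injective (cornerMap k (regularSocle k M) b)) :
    Function.Injective (cornerMap k M b) := by
  refine injective_cornerMap_iff.2 fun m hm => ?_
  by_contra hm0
  have hm' : arrow k (!b) • m ≠ 0 := fun hm' =>
    hm0 (hM.e₂_smul_eq_zero_of_arrow_smul_eq_zero h0 (Bool.forall_bool' b |>.2 ⟨hm, hm'⟩))
  have : (Ideal.span {(X - C 0 : k[X])}).IsMaximal :=
    PrincipalIdealRing.isMaximal_of_irreducible (irreducible_X_sub_C 0)
  let ε := quotientSpanXSubCAlgEquiv (0 : k)
  let g : (k[X] ⧸ Ideal.span {(X - C 0 : k[X])}) →ₗ[k] M :=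
    LinearMap.toSpanSingleton k M (e₂ k • m) ∘ₗ ε.toLinearMap
  have hg (x) : g x = ε x • e₂ k • m := rfl
  have harrow (c : Bool) (x) : arrow k c • g x = ε x • arrow k c • m := by
    rw [hg, smul_comm, ← mul_smul, arrow_mul_e₂]
  let F : PolyRep k (!b) _ →ₗ[KroneckerAlgebra k] M := PolyRep.lift g
    (fun x => by rw [hg, smul_comm, ← mul_smul, e₂_mul_e₂])
    (fun x => by rw [Bool.not_not, harrow, hm, smul_zero, X_smul_quotient_X_sub_C, zero_smul,
      map_zero, smul_zero])
  have hF : Function.Injective F := PolyRep.lift_injective fun x hx => by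
    rw [harrow] at hx
    exact ε.map_eq_zero_iff.1 ((smul_eq_zero_iff_left hm').1 hx)
  have hmem : e₂ k • m ∈ regularSocle k M :=
    (isSimpleRegular_polyRep_quotient (X_sub_C_ne_zero 0) (!b)).range_le_regularSocle hF
      ⟨PolyRep.mk 0 1, by simp [F, PolyRep.lift_apply, hg]⟩
  have hm2 := injective_cornerMap_iff.1 h ⟨_, hmem⟩
    (Subtype.ext (by simp [← mul_smul, arrow_mul_e₂, hm]))
  refine hm0 ?_
  simpa [← mul_smul, e₂_mul_e₂] using congrArg Subtype.val hm2

end CornerMap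

theorem IsIndecomposable.pow_smul_eq_zero_or_injective {S Q : Type*} [CommRing S] [AddCommGroup Q]
    [Module S Q] [IsNoetherian S Q] [IsArtinian S Q] (h : IsIndecomposable S Q) (p : S) :
    (∃ n, ∀ u : Q, p ^ n • u = 0) ∨ Function.Injective fun u : Q => p • u := by
  let φ : Module.End S Q := algebraMap S (Module.End S Q) p
  have hφ (n : ℕ) (u : Q) : (φ ^ n) u = p ^ n • u := by rw [← map_pow]; rfl
  obtain ⟨n, hcompl, hn⟩ :=
    (φ.eventually_isCompl_ker_pow_range_pow.and (Filter.eventually_ge_atTop 1)).exists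
  rcases h.2 _ _ hcompl with hker | hrange
  · right
    obtain ⟨n, rfl⟩ := Nat.exists_eq_add_of_le' hn
    have hinj := LinearMap.ker_eq_bot.1 hker
    rw [pow_succ, Module.End.mul_eq_comp, LinearMap.coe_comp] at hinj
    exact hinj.of_comp
  · exact .inl ⟨n, fun u => by rw [← hφ, LinearMap.range_eq_bot.1 hrange, LinearMap.zero_apply]⟩

section Prufer

variable {k : Type u} [Field k] {b : Bool} {P : Type v} [AddCommGroup P] [Module k P]
  [Module k[X] P] [IsScalarTower k k[X] P] {p : k[X]} [(Ideal.span {p}).IsMaximal]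

theorem exists_regularSocle_eq_sub_span
    (f : regularSocle k (PolyRep k b P) ≃ₗ[KroneckerAlgebra k]
      PolyRep k b (k[X] ⧸ Ideal.span {p})) :
    ∃ v : P, v ≠ 0 ∧ p • v = 0 ∧
      regularSocle k (PolyRep k b P) = PolyRep.sub b (Submodule.span k[X] {v}) := by
  let Φ : PolyRep k b (k[X] ⧸ Ideal.span {p}) →ₗ[KroneckerAlgebra k] PolyRep k b P :=
    (regularSocle k (PolyRep k b P)).subtype ∘ₗ f.symm.toLinearMap
  have hΦ : Function.Injective Φ := Subtype.val_injective.comp f.symm.injective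
  obtain ⟨ψ, hψ⟩ := PolyRep.map_surjective Φ
  have hψinj : Function.Injective ψ := fun x y hxy =>
    congrArg Prod.fst (hΦ (hψ ▸ PolyRep.ext hxy rfl : Φ (PolyRep.mk x 0) = Φ (PolyRep.mk y 0)))
  have hsmul : ψ ∘ₗ (Ideal.span {p}).mkQ = LinearMap.toSpanSingleton k[X] P (ψ 1) :=
    LinearMap.ext_ring (one_smul k[X] _).symm
  have hrange : LinearMap.range ψ = Submodule.span k[X] {ψ 1} := by
    rw [← LinearMap.range_toSpanSingleton, ← hsmul,
      LinearMap.range_comp_of_range_eq_top ψ (Submodule.range_mkQ _)]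
  refine ⟨ψ 1, ?_, ?_, ?_⟩
  · have : Nontrivial (k[X] ⧸ Ideal.span {p}) :=
      Ideal.Quotient.nontrivial_iff.2 (Ideal.IsMaximal.ne_top ‹_›)
    exact (map_ne_zero_iff ψ hψinj).2 one_ne_zero
  · rw [← LinearMap.toSpanSingleton_apply k[X], ← hsmul, LinearMap.comp_apply,
      Submodule.mkQ_apply, (Submodule.Quotient.mk_eq_zero _).2 (Ideal.mem_span_singleton_self p),
      map_zero]
  · rw [← hrange, ← PolyRep.range_map, hψ, LinearMap.range_comp, LinearEquiv.range,
      Submodule.map_subtype_top]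

theorem IsRayModule.exists_isUniserialAt (hp : p ≠ 0) {n : ℕ}
    (h : IsRayModule k (PolyRep k b P) (PolyRep k b (k[X] ⧸ Ideal.span {p})) n) :
    ∃ v : P, IsUniserialAt p v := by
  obtain ⟨hind, ⟨hfin, -⟩, -, ⟨f⟩⟩ := h
  obtain ⟨v, hv0, hpv, hsocle⟩ := exists_regularSocle_eq_sub_span f
  have : Module.Finite k (P × P) := hfin
  have : Module.Finite k P :=
    Module.Finite.of_surjective _ (LinearMap.snd_surjective (R := k) (M := P))
  have : IsNoetherian k[X] P := isNoetherian_of_tower k inferInstance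
  have : IsArtinian k[X] P := isArtinian_of_tower k inferInstance
  refine ⟨v, fun u => ?_, hv0, le_antisymm (fun u hu => ?_) ?_⟩
  · rcases (PolyRep.isIndecomposable_iff.1 hind).pow_smul_eq_zero_or_injective p with ⟨n, hn⟩ | hinj
    · exact ⟨n, hn u⟩
    · exact absurd (hinj (hpv.trans (smul_zero p).symm)) hv0
  · rcases eq_or_ne u 0 with rfl | hu0
    · exact Submodule.zero_mem _
    have hle : PolyRep.sub b (Submodule.span k[X] {u}) ≤ regularSocle k (PolyRep k b P) :=
      le_sSup ((isSimpleRegular_polyRep_quotient hp b).congr (quotientEquivSub b hu0 hu))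
    rw [hsocle, PolyRep.sub_le_sub_iff] at hle
    exact hle (Submodule.mem_span_singleton_self u)
  · exact (Submodule.span_singleton_le_iff_mem _ _).2 hpv

theorem exists_isUniserialAt_of_isPrufer (hp : p ≠ 0)
    (h : IsPrufer k (PolyRep k b P) (PolyRep k b (k[X] ⧸ Ideal.span {p}))) :
    ∃ v : P, IsUniserialAt p v := by
  obtain ⟨c, hmono, htop, hc⟩ := h
  choose Q hQ using fun n : ℕ =>
    PolyRep.exists_eq_sub_of_isRegular (hc (n + 1) (Nat.le_add_left 1 n)).2.1
  have hQmono : Monotone Q := fun i j hij => by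
    rw [← PolyRep.sub_le_sub_iff (b := b), ← hQ, ← hQ]
    exact hmono (Nat.succ_le_succ hij)
  refine IsUniserialAt.exists_of_iSup_eq_top hQmono.directed_le ?_ fun n => ?_
  · refine PolyRep.sub_injective (b := b) (le_antisymm (PolyRep.sub_le_sub_iff.2 le_top) ?_)
    rw [PolyRep.sub_top, ← htop, ← hmono.iSup_nat_add 1]
    exact iSup_le fun n => hQ n ▸ PolyRep.sub_le_sub_iff.2 (le_iSup Q n)
  · let f := (PolyRep.subEquiv b (Q n)).trans (LinearEquiv.ofEq _ _ (hQ n).symm)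
    exact ((hc (n + 1) (Nat.le_add_left 1 n)).congr f.symm (.refl _ _)).exists_isUniserialAt hp

theorem IsPrufer.surjective_smul (hp : p ≠ 0)
    (h : IsPrufer k (PolyRep k b P) (PolyRep k b (k[X] ⧸ Ideal.span {p}))) {v : P}
    (hv : IsUniserialAt p v) : Function.Surjective fun u : P => p • u := by
  refine hv.exists_span_singleton_eq_top_or_surjective.resolve_left ?_
  rintro ⟨w, hw⟩
  obtain ⟨n, hn⟩ := hv.torsion w
  have := finite_of_span_singleton_eq_top (pow_ne_zero n hp) hn hw
  exact h.not_finite inferInstance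

theorem IsRayModule.bijective_cornerMap {M : Type v} [AddCommGroup M] [Module k M]
    [Module (KroneckerAlgebra k) M] [IsScalarTower k (KroneckerAlgebra k) M]
    {P : Type w} [AddCommGroup P] [Module k P] [Module k[X] P] [IsScalarTower k k[X] P] {n : ℕ}
    (h : IsRayModule k M (PolyRep k b P) n) : Function.Bijective (cornerMap k M b) := by
  obtain ⟨hind, hreg, -, ⟨f⟩⟩ := h
  have := hreg.1
  have hinj := injective_cornerMap_of_regularSocle hind hreg.defect_eq_zero
    (injective_cornerMap_of_injective PolyRep.bijective_cornerMap.1 f.injective)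
  exact ⟨hinj, surjective_cornerMap_of_defect_eq_zero hreg.defect_eq_zero hinj⟩

theorem bijective_cornerMap_of_iSup_eq_top {M : Type v} [AddCommGroup M] [Module k M]
    [Module (KroneckerAlgebra k) M] [IsScalarTower k (KroneckerAlgebra k) M] {ι : Type*}
    [Nonempty ι] {c : ι → Submodule (KroneckerAlgebra k) M} (hdir : Directed (· ≤ ·) c)
    (htop : ⨆ i, c i = ⊤) (h : ∀ i, Function.Bijective (cornerMap k (c i) b)) :
    Function.Bijective (cornerMap k M b) := by
  have hmem (m : M) : ∃ i, m ∈ c i :=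
    (Submodule.mem_iSup_of_directed c hdir).1 (htop ▸ Submodule.mem_top (x := m))
  refine ⟨injective_cornerMap_iff.2 fun m hm => ?_, surjective_cornerMap_iff.2 fun m => ?_⟩ <;>
    obtain ⟨i, hi⟩ := hmem m
  · exact congrArg Subtype.val (injective_cornerMap_iff.1 (h i).1 ⟨m, hi⟩ (Subtype.ext hm))
  · exact (surjective_cornerMap_iff.1 (h i).2 ⟨m, hi⟩).imp' _ fun _ hn => congrArg Subtype.val hn

theorem IsPrufer.exists_polyRep_equiv {M : Type v} [AddCommGroup M] [Module k M]
    [Module (KroneckerAlgebra k) M] [IsScalarTower k (KroneckerAlgebra k) M]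
    {P : Type w} [AddCommGroup P] [Module k P] [Module k[X] P] [IsScalarTower k k[X] P]
    (h : IsPrufer k M (PolyRep k b P)) :
    ∃ (Q : Type v) (_ : AddCommGroup Q) (_ : Module k Q) (_ : Module k[X] Q)
      (_ : IsScalarTower k k[X] Q), Nonempty (PolyRep k b Q ≃ₗ[KroneckerAlgebra k] M) := by
  obtain ⟨c, hmono, htop, hc⟩ := h
  have hmono' : Monotone fun n => c (n + 1) := fun i j hij => hmono (Nat.succ_le_succ hij)
  exact KroneckerAlgebra.exists_polyRep_equiv <|
    bijective_cornerMap_of_iSup_eq_top hmono'.directed_le ((hmono.iSup_nat_add 1).trans htop)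
      fun n => (hc (n + 1) (Nat.le_add_left 1 n)).bijective_cornerMap

theorem IsPrufer.nonempty_end_ringEquiv (hp : p ≠ 0) {M : Type v} [AddCommGroup M] [Module k M]
    [Module (KroneckerAlgebra k) M] [IsScalarTower k (KroneckerAlgebra k) M]
    {U : Type*} [AddCommGroup U] [Module (KroneckerAlgebra k) U] {K : Type*} [CommRing K]
    (f : PolyRep k b (k[X] ⧸ Ideal.span {p}) ≃ₗ[KroneckerAlgebra k] U)
    (e : K ≃+* k[X] ⧸ Ideal.span {p}) (h : IsPrufer k M U) :
    Nonempty (Module.End (KroneckerAlgebra k) M ≃+* PowerSeries K) := by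
  have h' : IsPrufer k M (PolyRep k b (k[X] ⧸ Ideal.span {p})) := h.congr (.refl _ _) f.symm
  obtain ⟨P, _, _, _, _, ⟨g⟩⟩ := h'.exists_polyRep_equiv
  have hP := h'.congr g.symm (.refl _ _)
  obtain ⟨v, hv⟩ := exists_isUniserialAt_of_isPrufer hp hP
  obtain ⟨r⟩ := hv.nonempty_end_ringEquiv_powerSeries k (hP.surjective_smul hp hv) e
  exact ⟨(g.symm.conjRingEquiv.trans (PolyRep.endRingEquiv k b P).symm).trans r⟩

end Prufer

theorem exists_isPrufer {k : Type u} [Field k] {b : Bool} {p : k[X]} (hp : Irreducible p)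
    {U : Type w} [AddCommGroup U] [Module (KroneckerAlgebra k) U]
    (f : PolyRep k b (k[X] ⧸ Ideal.span {p}) ≃ₗ[KroneckerAlgebra k] U) :
    ∃ (M : Type u) (_ : AddCommGroup M) (_ : Module k M) (_ : Module (KroneckerAlgebra k) M)
      (_ : IsScalarTower k (KroneckerAlgebra k) M), IsPrufer k M U := by
  have : (Ideal.span {p}).IsMaximal := PrincipalIdealRing.isMaximal_of_irreducible hp
  have hv := AwayModSelf.isUniserialAt (mem_nonZeroDivisors_of_ne_zero hp.ne_zero) hp.not_isUnit
  exact ⟨PolyRep k b (AwayModSelf p), inferInstance, inferInstance, inferInstance, inferInstance,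
    (isPrufer_polyRep hv hp.ne_zero AwayModSelf.surjective_smul).congr (.refl _ _) f⟩

section Models

variable {k : Type u} [Field k]

/-- `V_p` as the representation of a `k[X]`-module. -/
noncomputable def polyRepEquivVp (p : k[X]) :
    PolyRep k false (k[X] ⧸ Ideal.span {p}) ≃ₗ[KroneckerAlgebra k] Vp p where
  toFun m := m
  invFun m := m
  map_add' _ _ := rfl
  map_smul' r m := by
    obtain ⟨f, hf⟩ := Ideal.Quotient.mk_surjective m.2
    refine Prod.ext ?_ rfl
    change r.a • m.1 + r.c • ((1 : k[X]) • m.2) + r.d • ((X : k[X]) • m.2) =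
      r.a • m.1 + r.c • m.2 + r.d • (Ideal.Quotient.mk (Ideal.span {p}) X * m.2)
    rw [one_smul, ← hf]
    rfl
  left_inv _ := rfl
  right_inv _ := rfl

/-- `V` as the representation of a `k[X]`-module. -/
noncomputable def polyRepEquivV :
    PolyRep k true (k[X] ⧸ Ideal.span {(X - C 0 : k[X])}) ≃ₗ[KroneckerAlgebra k] V k :=
  let ε : (k[X] ⧸ Ideal.span {(X - C 0 : k[X])}) ≃ₗ[k] k :=
    (quotientSpanXSubCAlgEquiv (0 : k)).toLinearEquiv
  { ε.prodCongr ε with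
    map_smul' := fun r m => by
      refine Prod.ext ?_ (map_smul ε _ _)
      change ε (r.a • m.1 + r.c • (X : k[X]) • m.2 + r.d • (1 : k[X]) • m.2) =
        r.a • ε m.1 + r.c • (0 : k) + r.d • ε m.2
      rw [X_smul_quotient_X_sub_C, zero_smul, one_smul]
      simp only [map_add, map_smul, map_zero] }

end Models

end KroneckerAlgebra

theorem corollary4p4 (k : Type u) [Field k] :
    ((∃ (M : Type u) (_ : AddCommGroup M) (_ : Module k M) (_ : Module (KroneckerAlgebra k) M)
        (_ : IsScalarTower k (KroneckerAlgebra k) M),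
        KroneckerAlgebra.IsPrufer k M (KroneckerAlgebra.V k)) ∧
      ∀ (M : Type v) [AddCommGroup M] [Module k M] [Module (KroneckerAlgebra k) M]
        [IsScalarTower k (KroneckerAlgebra k) M],
        KroneckerAlgebra.IsPrufer k M (KroneckerAlgebra.V k) →
          Nonempty (Module.End (KroneckerAlgebra k) M ≃+* PowerSeries k)) ∧
    ∀ p : k[X], p.Monic → Irreducible p →
      (∃ (M : Type u) (_ : AddCommGroup M) (_ : Module k M) (_ : Module (KroneckerAlgebra k) M)
        (_ : IsScalarTower k (KroneckerAlgebra k) M),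
        KroneckerAlgebra.IsPrufer k M (KroneckerAlgebra.Vp p)) ∧
      ∀ (M : Type v) [AddCommGroup M] [Module k M] [Module (KroneckerAlgebra k) M]
        [IsScalarTower k (KroneckerAlgebra k) M],
        KroneckerAlgebra.IsPrufer k M (KroneckerAlgebra.Vp p) →
          Nonempty (Module.End (KroneckerAlgebra k) M ≃+* PowerSeries (AdjoinRoot p)) := by
  refine ⟨?_, fun p _ hp => ?_⟩
  · have hX : Irreducible (X - C 0 : k[X]) := irreducible_X_sub_C 0
    have : (Ideal.span {(X - C 0 : k[X])}).IsMaximal :=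
      PrincipalIdealRing.isMaximal_of_irreducible hX
    exact ⟨KroneckerAlgebra.exists_isPrufer hX KroneckerAlgebra.polyRepEquivV,
      fun M _ _ _ _ h => h.nonempty_end_ringEquiv hX.ne_zero KroneckerAlgebra.polyRepEquivV
        (quotientSpanXSubCAlgEquiv (0 : k)).symm.toRingEquiv⟩
  · have : (Ideal.span {p}).IsMaximal := PrincipalIdealRing.isMaximal_of_irreducible hp
    exact ⟨KroneckerAlgebra.exists_isPrufer hp (KroneckerAlgebra.polyRepEquivVp p),
      fun M _ _ _ _ h => h.nonempty_end_ringEquiv hp.ne_zero (KroneckerAlgebra.polyRepEquivVp p)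
        (RingEquiv.refl _)⟩
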